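/- Let $\lambda=(\lambda_1\ge\dots\ge\lambda_r>0)$ be a partition and $b\ge r$ an integer. For a cell $\rho=(i,j)$ (row $i$, column $j$) of the Ferrers diagram of $\lambda$ let $a_\rho=\lambda_i-j$, $l_\rho=\lambda'_j-i$, $h_\rho=a_\rho+l_\rho+1$ and $c_\rho=j-i$. Consider fillings $F$ of the cells with integers; $n(F)$ is the sum of the entries. A tableau is a filling with weakly increasing rows and strictly increasing columns; a hook tabloid is a filling with entry in $[-a_\rho,l_\rho]$ in each cell $\rho$; a content tabloid is a filling with entry in $[1-c_\rho,b]$ in each cell $\rho$. Order the cells column by column from left to right, each column from top to bottom. Algorithm HC. Start with $(T,H)=(C,0)$, where $C$ is a content tabloid. For each cell $\omega=(i,j)$, from the last to the first, do the following. Move the entry $s$ of $T$ in $\omega$ as follows: if $s$ has right neighbour $x$ and lower neighbour $y$ ($\infty$ if absent), stop if $s\le x$ and $s<y$; otherwise, if $x+1<y$, exchange $s$ with $x$ and replace $x$ by $x+1$, and if $x\ge y-1$, exchange $s$ with $y$ and replace $y$ by $y-1$; repeat. If $s$ stops in $(i',j')$, replace $H_{(k,j)}$ by $H_{(k+1,j)}+1$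 for $i\le k<i'$, and $H_{(i',j)}$ by $j-j'$. The output is the final $(T,H)$. Algorithm HC*. Start with $(T,H)$, where $T$ is a tableau with entries in $[1,b]$ and $H$ is a hook tabloid. For each cell $\omega=(i,j)$, from the first to the last, do the following. For each entry $e=H_{(k,j)}\le 0$ with $k\ge i$ call $(k,j-e)$ a candidate cell. From each candidate cell move its entry $s$ backwards until it is in $\omega$: if $s$ has left neighbour $x$ ($-\infty$ if $s$ is in column $j$) and upper neighbour $y$ ($-\infty$ if absent), then, if $x-1>y$, exchange $s$ with $x$ and replace $x$ by $x-1$, and if $x\le y+1$, exchange $s$ with $y$ and replace $y$ by $y+1$. The cells visited form the backward path of the candidate. A backward path $P$ comes before another one, $Q$, if, where they separate as seen from $\omega$, $P$ continues to the right and $Q$ continues downwards or ends, or $P$ ends and $Q$ continues downwards. Perform on $T$ the move whose backward path is first; if it starts in row $i'$, replace $H_{(k,j)}$ by $H_{(k-1,j)}-1$ for $i<k\le i'$, and $H_{(i,j)}$ by $0$. The output is the final $T$. Then: 1. Algorithm HC is a bijection from the set of content tabloids of shape $\lambda$ onto the set of pairs $(T,H)$ of a tableau $T$ of shape $\lambda$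 with entries in $[1,b]$ and a hook tabloid $H$ of shape $\lambda$, and $n(T)+n(H)=n(C)$ whenever it maps $C$ to $(T,H)$. 2. Algorithm HC* is well defined on all such pairs (all candidate cells lie in $\lambda$, all backward paths reach $\omega$, and there is always a first one), its outputs are content tabloids, and it is the two-sided inverse of Algorithm HC. 3. With $T$ running over all tableaux of shape $\lambda$ with entries in $[1,b]$, $$\Big(\sum_T q^{n(T)}\Big)\prod_{\rho\in\lambda}\big(q^{-a_\rho}+q^{-a_\rho+1}+\dots+q^{l_\rho}\big)=\prod_{\rho\in\lambda}\big(q^{1-c_\rho}+q^{2-c_\rho}+\dots+q^{b}\big).$$ 4. (Stanley's hook-content formula) $$\sum_T q^{n(T)}=q^{\sum_{i=1}^r i\lambda_i}\prod_{\rho\in\lambda}\frac{1-q^{b+c_\rho}}{1-q^{h_\rho}}.$$ -/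

import Mathlib

noncomputable section

namespace HookContent

/-- The type of cells of the Ferrers diagram `μ`. A cell is a pair `(row, column)`, counted
from `0`, rows from top to bottom and columns from left to right. -/
abbrev Cell (μ : YoungDiagram) : Type := {c : ℕ × ℕ // c ∈ μ.cells}

/-- A filling of the cells of `μ` with integers. -/
abbrev Filling (μ : YoungDiagram) : Type := Cell μ → ℤ

variable {μ : YoungDiagram}

/-- The norm of a filling: the sum of all its entries. -/
def tabNorm (F : Filling μ) : ℤ := ∑ ρ, F ρ

/-- The content `c_ρ`: column minus row. -/
def content (ρ : Cell μ) : ℤ := (ρ.1.2 : ℤ) - (ρ.1.1 : ℤ)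

/-- The arm length `a_ρ`: the number of cells to the right of `ρ` in its row. -/
def arm (ρ : Cell μ) : ℤ := (μ.rowLen ρ.1.1 : ℤ) - (ρ.1.2 : ℤ) - 1

/-- The leg length `l_ρ`: the number of cells below `ρ` in its column. -/
def leg (ρ : Cell μ) : ℤ := (μ.colLen ρ.1.2 : ℤ) - (ρ.1.1 : ℤ) - 1

/-- The hook length `h_ρ`. -/
def hook (ρ : Cell μ) : ℤ := arm ρ + leg ρ + 1

/-- Rows weakly increasing, columns strictly increasing. -/
def IsSemistandard (T : Filling μ) : Prop :=
  (∀ ρ σ : Cell μ, ρ.1.1 = σ.1.1 → ρ.1.2 < σ.1.2 → T ρ ≤ T σ) ∧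
  (∀ ρ σ : Cell μ, ρ.1.2 = σ.1.2 → ρ.1.1 < σ.1.1 → T ρ < T σ)

instance (T : Filling μ) : Decidable (IsSemistandard T) := by
  unfold IsSemistandard
  infer_instance

/-- Semistandard tableaux of shape `μ` with entries between `1` and `b`. -/
def tableaux (μ : YoungDiagram) (b : ℕ) : Finset (Filling μ) :=
  (Fintype.piFinset fun _ : Cell μ => Finset.Icc (1 : ℤ) (b : ℤ)).filter IsSemistandard

/-- Hook tabloids: the entry in cell `ρ` is between `-a_ρ` and `l_ρ`. -/
def hookTabloids (μ : YoungDiagram) : Finset (Filling μ) :=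
  Fintype.piFinset fun ρ : Cell μ => Finset.Icc (-arm ρ) (leg ρ)

/-- Content tabloids: the entry in cell `ρ` is between `1 - c_ρ` and `b`. -/
def contentTabloids (μ : YoungDiagram) (b : ℕ) : Finset (Filling μ) :=
  Fintype.piFinset fun ρ : Cell μ => Finset.Icc (1 - content ρ) (b : ℤ)

/-- The entry of a filling at a position, with value `0` outside the diagram; the algorithms
below only evaluate it at positions inside the diagram. -/
def entry (F : Filling μ) (p : ℕ × ℕ) : ℤ :=
  if h : p ∈ μ.cells then F ⟨p, h⟩ else 0

/-- The entry of a filling at a position, with value `∞` outside the diagram. -/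
def entryTop (F : Filling μ) (p : ℕ × ℕ) : WithTop ℤ :=
  if h : p ∈ μ.cells then ((F ⟨p, h⟩ : ℤ) : WithTop ℤ) else ⊤

/-- The total order of the cells, as a list: column by column from left to right, each column
from top to bottom. -/
def cellList (μ : YoungDiagram) : List (Cell μ) :=
  (List.range (μ.rowLen 0)).flatMap fun j =>
    (List.range (μ.colLen j)).pmap
      (fun i (hi : i < μ.colLen j) =>
        ⟨(i, j), (YoungDiagram.mem_cells _).2 (YoungDiagram.mem_iff_lt_colLen.2 hi)⟩)
      (fun _ hi => List.mem_range.1 hi)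

/-- Move the (special) entry of cell `c` into cell `d`, and write the integer `v` in `c`. -/
def slide (T : Filling μ) (c d : Cell μ) (v : ℤ) : Filling μ :=
  Function.update (Function.update T c v) d (T c)

/-! ### The forward algorithm -/

/-- One step of forward modified jeu de taquin, the special entry being in cell `c`. The result
is `none` if the special entry stops in `c`; otherwise it is the new filling together with the
new cell of the special entry. With `s` the special entry, `x` its right neighbour and `y` its
bottom neighbour (`∞` if absent): stop if `s ≤ x` and `s < y`; otherwise move to the right and
replace `x` by `x + 1` if `x + 1 < y`, and move down and replace `y` by `y - 1` if `x ≥ y - 1`.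
(The two remaining `none` branches, for a move out of the diagram, never occur.) -/
def jtStep (T : Filling μ) (c : Cell μ) : Option (Filling μ × Cell μ) :=
  let x := entryTop T (c.1.1, c.1.2 + 1)
  let y := entryTop T (c.1.1 + 1, c.1.2)
  if ((T c : ℤ) : WithTop ℤ) ≤ x ∧ ((T c : ℤ) : WithTop ℤ) < y then none
  else if x + 1 < y then
    if h : (c.1.1, c.1.2 + 1) ∈ μ.cells then
      some (slide T c ⟨_, h⟩ (T ⟨_, h⟩ + 1), ⟨_, h⟩)
    else none
  else
    if h : (c.1.1 + 1, c.1.2) ∈ μ.cells then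
      some (slide T c ⟨_, h⟩ (T ⟨_, h⟩ - 1), ⟨_, h⟩)
    else none

theorem cell_lt (c : Cell μ) : c.1.1 < μ.colLen 0 ∧ c.1.2 < μ.rowLen 0 := by
  have h : (c.1.1, c.1.2) ∈ μ := (YoungDiagram.mem_cells _).1 c.2
  exact ⟨YoungDiagram.mem_iff_lt_colLen.1 (μ.up_left_mem le_rfl (Nat.zero_le _) h),
    YoungDiagram.mem_iff_lt_rowLen.1 (μ.up_left_mem (Nat.zero_le _) le_rfl h)⟩

theorem jtStep_sum {T : Filling μ} {c : Cell μ} {p : Filling μ × Cell μ}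
    (h : jtStep T c = some p) : p.2.1.1 + p.2.1.2 = c.1.1 + c.1.2 + 1 := by
  unfold jtStep at h
  dsimp only at h
  split_ifs at h
  · simp only [Option.some.injEq] at h
    subst h
    dsimp only
    omega
  · simp only [Option.some.injEq] at h
    subst h
    dsimp only
    omega

/-- Move the entry of cell `c` to the right/bottom by modified jeu de taquin: iterate `jtStep`
until the special entry stops. The result is the final filling together with the cell where the
special entry stops. -/
def jt (T : Filling μ) (c : Cell μ) : Filling μ × Cell μ :=
  match h : jtStep T c with
  | none => (T, c)
  | some p => jt p.1 p.2
termination_by μ.colLen 0 + μ.rowLen 0 - (c.1.1 + c.1.2)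
decreasing_by
  have h1 := jtStep_sum h
  have h2 := cell_lt p.2
  omega

/-- The update of the hook tabloid when the special entry went from `ω = (i, j)` to
`ω' = (i', j')`: for `i ≤ k < i'`, the entry in `(k, j)` becomes `H (k + 1, j) + 1`; the entry in
`(i', j)` becomes `j - j'`; the others are unchanged. -/
def shiftUp (ω ω' : Cell μ) (H : Filling μ) : Filling μ := fun ρ =>
  if ρ.1.2 = ω.1.2 ∧ ω.1.1 ≤ ρ.1.1 ∧ ρ.1.1 < ω'.1.1 then
    entry H (ρ.1.1 + 1, ρ.1.2) + 1
  else if ρ.1 = (ω'.1.1, ω.1.2) then (ω.1.2 : ℤ) - (ω'.1.2 : ℤ)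
  else H ρ

/-- One loop of Algorithm HC, with distinguished cell `ω`. -/
def loopHC (ω : Cell μ) (p : Filling μ × Filling μ) : Filling μ × Filling μ :=
  let r := jt p.1 ω
  (r.1, shiftUp ω r.2 p.2)

/-- Algorithm HC: starting from `(C, 0)`, perform one loop for each cell of `μ`, from the last
cell to the first cell in the total order of the cells. -/
def algHC (C : Filling μ) : Filling μ × Filling μ :=
  (cellList μ).foldr loopHC (C, 0)

/-! ### The inverse algorithm -/

/-- The left neighbour of `c`, if `c` is not in the first column. -/
def leftCell (c : Cell μ) : Cell μ :=
  ⟨(c.1.1, c.1.2 - 1), (YoungDiagram.mem_cells _).2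
    (μ.up_left_mem le_rfl (Nat.sub_le _ _) ((YoungDiagram.mem_cells _).1 c.2))⟩

/-- The upper neighbour of `c`, if `c` is not in the first row. -/
def upCell (c : Cell μ) : Cell μ :=
  ⟨(c.1.1 - 1, c.1.2), (YoungDiagram.mem_cells _).2
    (μ.up_left_mem (Nat.sub_le _ _) le_rfl ((YoungDiagram.mem_cells _).1 c.2))⟩

/-- One step of backward modified jeu de taquin towards `ω`, the special entry being in a cell
`c ≠ ω`. With `x` its left neighbour (`-∞` if `c` is in the column of `ω`) and `y` its upper
neighbour (`-∞` if `c` is in the first row): move to the left and replace `x` by `x - 1` if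
`x - 1 > y`, and move up and replace `y` by `y + 1` if `x ≤ y + 1`. The result is `none` if no
move is possible. -/
def jtStarStep (ω : Cell μ) (T : Filling μ) (c : Cell μ) : Option (Filling μ × Cell μ) :=
  let x : WithBot ℤ := if c.1.2 ≤ ω.1.2 then ⊥ else ((T (leftCell c) : ℤ) : WithBot ℤ)
  let y : WithBot ℤ := if c.1.1 = 0 then ⊥ else ((T (upCell c) : ℤ) : WithBot ℤ)
  if y + 1 < x then some (slide T c (leftCell c) (T (leftCell c) - 1), leftCell c)
  else if c.1.1 = 0 then none
  else some (slide T c (upCell c) (T (upCell c) + 1), upCell c)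

theorem jtStarStep_lt {ω : Cell μ} {T : Filling μ} {c : Cell μ} {p : Filling μ × Cell μ}
    (h : jtStarStep ω T c = some p) : p.2.1.1 + p.2.1.2 < c.1.1 + c.1.2 := by
  unfold jtStarStep at h
  dsimp only at h
  by_cases hx : c.1.2 ≤ ω.1.2
  · rw [if_pos hx, if_neg not_lt_bot] at h
    split_ifs at h
    simp only [Option.some.injEq] at h
    subst h
    simp only [upCell]
    omega
  · split_ifs at h <;>
    · simp only [Option.some.injEq] at h
      subst h
      simp only [upCell, leftCell]
      omega

/-- Move the entry of cell `c` to the left/top until `ω` by modified jeu de taquin. The result is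
`none` if the special entry misses `ω`; otherwise it is the final filling together with the
backward path of `c` until `ω`, listed from `ω` to `c`. -/
def jtStar (ω : Cell μ) (T : Filling μ) (c : Cell μ) : Option (Filling μ × List (ℕ × ℕ)) :=
  if c = ω then some (T, [ω.1])
  else
    match h : jtStarStep ω T c with
    | none => none
    | some p => (jtStar ω p.1 p.2).map fun r => (r.1, r.2 ++ [c.1])
termination_by c.1.1 + c.1.2
decreasing_by exact jtStarStep_lt h

/-- The order of backward paths ending in the same cell `ω` (the lists start with `ω`), which do
not cross: `P` comes before `Q` if, where they separate (as seen from `ω`), (a) `P` is to the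
right and above of `Q`; or (b) `P` is contained in `Q` and `Q` enters `P` from below; or
(c) `P` contains `Q` and enters `Q` from the right. -/
def comesBefore : List (ℕ × ℕ) → List (ℕ × ℕ) → Bool
  | c :: c' :: P, d :: d' :: Q =>
      if c' = d' then comesBefore (c' :: P) (d' :: Q)
      else decide (c' = (c.1, c.2 + 1) ∧ d' = (d.1 + 1, d.2))
  | [_], d :: d' :: _ => decide (d' = (d.1 + 1, d.2))
  | c :: c' :: _, [_] => decide (c' = (c.1, c.2 + 1))
  | _, _ => false

/-- The candidate cells for the distinguished cell `ω = (i, j)`: for every nonpositive entry `e`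
of `H` in a cell `(k, j)` with `k ≥ i`, the cell `(k, j - e)`. -/
def candidates (ω : Cell μ) (H : Filling μ) : List (ℕ × ℕ) :=
  ((List.range (μ.colLen ω.1.2)).filter fun k =>
      decide (ω.1.1 ≤ k ∧ entry H (k, ω.1.2) ≤ 0)).map
    fun k => (k, ω.1.2 + (-entry H (k, ω.1.2)).toNat)

/-- The update of the hook tabloid when the special entry went from a cell in row `i'` to
`ω = (i, j)`: for `i < k ≤ i'`, the entry in `(k, j)` becomes `H (k - 1, j) - 1`; the entry in
`ω` becomes `0`; the others are unchanged. -/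
def shiftDown (ω : Cell μ) (i' : ℕ) (H : Filling μ) : Filling μ := fun ρ =>
  if ρ.1.2 = ω.1.2 ∧ ω.1.1 < ρ.1.1 ∧ ρ.1.1 ≤ i' then
    entry H (ρ.1.1 - 1, ρ.1.2) - 1
  else if ρ = ω then 0
  else H ρ

/-- The backward move from position `p` until `ω`: `p`, the final filling, and the backward path.
It is `none` if `p` is not a cell of `μ` or if the backward path misses `ω`. -/
def backwardMove (ω : Cell μ) (T : Filling μ) (p : ℕ × ℕ) :
    Option ((ℕ × ℕ) × Filling μ × List (ℕ × ℕ)) :=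
  if h : p ∈ μ.cells then (jtStar ω T ⟨p, h⟩).map fun r => (p, r) else none

/-- One loop of Algorithm HC*, with distinguished cell `ω`: among all candidate cells take the one
whose backward path comes before the backward paths of all other candidate cells, and perform the
corresponding move. The result is `none` if the loop is not well-defined, i.e. if some candidate
is not a cell of `μ`, or some backward path misses `ω`, or there is no first backward path. -/
def loopHCStar (p : Filling μ × Filling μ) (ω : Cell μ) : Option (Filling μ × Filling μ) :=
  ((candidates ω p.2).mapM (backwardMove ω p.1)).bind fun l =>
    (l.find? fun m => l.all fun m' => decide (m'.1 = m.1) || comesBefore m.2.2 m'.2.2).map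
      fun m => (m.2.1, shiftDown ω m.1.1 p.2)

/-- Algorithm HC*: starting from `(T, H)`, perform one loop for each cell of `μ`, from the first
cell to the last cell in the total order of the cells; the output is the final first component.
It is `none` if one of the loops is not well-defined. -/
def algHCStar (p : Filling μ × Filling μ) : Option (Filling μ) :=
  ((cellList μ).foldlM loopHCStar p).map Prod.fst

end HookContent

end

namespace HookContent

variable {μ : YoungDiagram}

/-! A loop for `ω = (i, j)` inserts the entry of `ω` into the later cells, which already form a
tableau. The slides are reversible: the change by one of the displaced entry is exactly what makes
the backward rule choose the opposite move, and conversely (`forward_of_ordered`,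
`backward_of_ordered`). To invert a loop it is therefore enough to recover the cell `(i', j')` where
the special entry stopped, and this is what the hook tabloid records.

The nonpositive entries of `H` in column `j` point to candidate cells, and the invariant `IsState`
demands that the backward paths of all of them reach the current cell. A loop makes `(i', j')` a
candidate, moves a candidate `(k + 1, c + 1)` with `i ≤ k < i'` diagonally to `(k, c)` (it
disappears if it was in column `j`), and keeps the candidates below row `i'`. Let `top c` be the row
in which the sliding path enters column `c`. Since the fillings `T` before and `T'` after the slide
are ordered, backward paths cannot cross the sliding path, and this yields two criteria. In `T`, a
cell `(r, c)` reaches `(i + 1, j)` iff `top c < r` and its path stays below row `i'` as long as it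
is to the right of column `j'` (`Far`). In `T'`, the backward path of `(r, c) ≠ (i', j')` comes
after the sliding path iff `top (c + 1) ≤ r` and `Far` holds. Under the diagonal shift the two
inequalities are the same. So `(i', j')` is the first candidate after a loop, and undoing the move
of a first candidate leaves a valid state: this is `loopHC_spec` and `loopHCStar_spec`, which
`LoopsInverse` composes over all cells.

Steps to the right raise the norm of `T` by one and steps down lower it by one; the update of `H`
compensates. Summing `q ^ n` over both sides of the bijection gives the product identity, and
geometric sums turn it into the hook-content formula. -/

theorem entry_mk (T : Filling μ) (p : ℕ × ℕ) (h : p ∈ μ.cells) : entry T p = T ⟨p, h⟩ := by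
  simp [entry, h]

theorem entry_coe (T : Filling μ) (c : Cell μ) : entry T c.1 = T c := entry_mk T c.1 c.2

theorem entry_of_notMem (T : Filling μ) {p : ℕ × ℕ} (h : p ∉ μ) : entry T p = 0 := by
  simp [entry, h]

theorem filling_ext {T T' : Filling μ} (h : ∀ r c, (r, c) ∈ μ → entry T (r, c) = entry T' (r, c)) :
    T = T' := by
  funext ρ
  have := h ρ.1.1 ρ.1.2 ((YoungDiagram.mem_cells _).1 ρ.2)
  rwa [Prod.mk.eta, entry_coe, entry_coe] at this

theorem mem_of_le {r c r' c' : ℕ} (h : (r', c') ∈ μ) (hr : r ≤ r') (hc : c ≤ c') : (r, c) ∈ μ :=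
  μ.up_left_mem hr hc h

theorem entry_slide (T : Filling μ) (c d : Cell μ) (v : ℤ) (p : ℕ × ℕ) :
    entry (slide T c d v) p = if p = d.1 then T c else if p = c.1 then v else entry T p := by
  by_cases hp : p ∈ μ.cells
  · rw [entry_mk _ _ hp, entry_mk _ _ hp, slide]
    simp only [Function.update_apply, Subtype.ext_iff]
  · have h1 : p ≠ d.1 := fun h => hp (h ▸ d.2)
    have h2 : p ≠ c.1 := fun h => hp (h ▸ c.2)
    rw [if_neg h1, if_neg h2, entry, entry, dif_neg hp, dif_neg hp]

theorem slide_slide (T : Filling μ) (c d : Cell μ) (v w : ℤ) (hw : T d = w) :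
    slide (slide T c d v) d c w = T := by
  funext ρ
  simp only [slide, Function.update_apply]
  grind

/-! ### Single steps of forward jeu de taquin. -/

/-- The three possible outcomes of a step of forward jeu de taquin. -/
theorem jtStep_cases (T : Filling μ) (c : Cell μ) :
    (jtStep T c = none ∧
      ((c.1.1, c.1.2 + 1) ∈ μ → entry T (c.1.1, c.1.2) ≤ entry T (c.1.1, c.1.2 + 1)) ∧
      ((c.1.1 + 1, c.1.2) ∈ μ → entry T (c.1.1, c.1.2) < entry T (c.1.1 + 1, c.1.2))) ∨
    (∃ d : Cell μ, d.1 = (c.1.1, c.1.2 + 1) ∧ jtStep T c = some (slide T c d (T d + 1), d) ∧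
      entry T (c.1.1, c.1.2 + 1) < entry T (c.1.1, c.1.2) ∧
      ((c.1.1 + 1, c.1.2) ∈ μ →
        entry T (c.1.1, c.1.2 + 1) + 1 < entry T (c.1.1 + 1, c.1.2))) ∨
    (∃ d : Cell μ, d.1 = (c.1.1 + 1, c.1.2) ∧ jtStep T c = some (slide T c d (T d - 1), d) ∧
      entry T (c.1.1 + 1, c.1.2) ≤ entry T (c.1.1, c.1.2) ∧
      ((c.1.1, c.1.2 + 1) ∈ μ →
        entry T (c.1.1 + 1, c.1.2) ≤ entry T (c.1.1, c.1.2 + 1) + 1)) := by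
  have hc : entry T (c.1.1, c.1.2) = T c := entry_coe T c
  rw [hc]
  by_cases hx : (c.1.1, c.1.2 + 1) ∈ μ.cells <;> by_cases hy : (c.1.1 + 1, c.1.2) ∈ μ.cells
  · have hx' : (c.1.1, c.1.2 + 1) ∈ μ := (YoungDiagram.mem_cells _).1 hx
    have hy' : (c.1.1 + 1, c.1.2) ∈ μ := (YoungDiagram.mem_cells _).1 hy
    have e1 : entryTop T (c.1.1, c.1.2 + 1) = (T ⟨_, hx⟩ : ℤ) := by simp [entryTop, hx']
    have e2 : entryTop T (c.1.1 + 1, c.1.2) = (T ⟨_, hy⟩ : ℤ) := by simp [entryTop, hy']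
    rw [entry_mk T _ hx, entry_mk T _ hy]
    unfold jtStep
    simp only [e1, e2, dif_pos hx, dif_pos hy]
    norm_cast
    split_ifs with h1 h2
    · exact Or.inl ⟨rfl, fun _ => h1.1, fun _ => h1.2⟩
    · exact Or.inr (Or.inl ⟨_, rfl, rfl, by omega, fun _ => h2⟩)
    · exact Or.inr (Or.inr ⟨_, rfl, rfl, by omega, fun _ => by omega⟩)
  · have hx' : (c.1.1, c.1.2 + 1) ∈ μ := (YoungDiagram.mem_cells _).1 hx
    have hy' : (c.1.1 + 1, c.1.2) ∉ μ := fun h => hy ((YoungDiagram.mem_cells _).2 h)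
    have e1 : entryTop T (c.1.1, c.1.2 + 1) = (T ⟨_, hx⟩ : ℤ) := by simp [entryTop, hx']
    have e2 : entryTop T (c.1.1 + 1, c.1.2) = ⊤ := by simp [entryTop, hy']
    rw [entry_mk T _ hx]
    unfold jtStep
    simp only [e1, e2, dif_pos hx]
    norm_cast
    split_ifs with h1 h2
    · exact Or.inl ⟨rfl, fun _ => h1.1, fun h => absurd h hy'⟩
    · refine Or.inr (Or.inl ⟨_, rfl, rfl, ?_, fun h => absurd h hy'⟩)
      by_contra h
      exact h1 ⟨by omega, WithTop.coe_lt_top _⟩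
    · exact absurd (WithTop.coe_lt_top _) h2
  · have hx' : (c.1.1, c.1.2 + 1) ∉ μ := fun h => hx ((YoungDiagram.mem_cells _).2 h)
    have hy' : (c.1.1 + 1, c.1.2) ∈ μ := (YoungDiagram.mem_cells _).1 hy
    have e1 : entryTop T (c.1.1, c.1.2 + 1) = ⊤ := by simp [entryTop, hx']
    have e2 : entryTop T (c.1.1 + 1, c.1.2) = (T ⟨_, hy⟩ : ℤ) := by simp [entryTop, hy']
    rw [entry_mk T _ hy]
    unfold jtStep
    simp only [e1, e2, dif_pos hy, top_add, not_top_lt, le_top, true_and, if_false]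
    norm_cast
    split_ifs with h1
    · exact Or.inl ⟨rfl, fun h => absurd h hx', fun _ => h1⟩
    · exact Or.inr (Or.inr ⟨_, rfl, rfl, by omega, fun h => absurd h hx'⟩)
  · have hx' : (c.1.1, c.1.2 + 1) ∉ μ := fun h => hx ((YoungDiagram.mem_cells _).2 h)
    have hy' : (c.1.1 + 1, c.1.2) ∉ μ := fun h => hy ((YoungDiagram.mem_cells _).2 h)
    refine Or.inl ⟨?_, fun h => absurd h hx', fun h => absurd h hy'⟩
    have e1 : entryTop T (c.1.1, c.1.2 + 1) = ⊤ := by simp [entryTop, hx']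
    have e2 : entryTop T (c.1.1 + 1, c.1.2) = ⊤ := by simp [entryTop, hy']
    unfold jtStep
    simp only [e1, e2]
    rw [if_pos ⟨le_top, WithTop.coe_lt_top _⟩]

theorem jt_of_none {T : Filling μ} {c : Cell μ} (h : jtStep T c = none) : jt T c = (T, c) := by
  rw [jt]
  split <;> simp_all

theorem jt_of_some {T : Filling μ} {c : Cell μ} {p : Filling μ × Cell μ} (h : jtStep T c = some p) :
    jt T c = jt p.1 p.2 := by
  rw [jt]
  split <;> simp_all

/-! ### Backward paths as sequences of positions. -/

/-- The step of the backward path, as a function of the position only. -/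
def backStep (j : ℕ) (T : Filling μ) (p : ℕ × ℕ) : ℕ × ℕ :=
  if j < p.2 ∧ (p.1 = 0 ∨ entry T (p.1 - 1, p.2) + 1 < entry T (p.1, p.2 - 1)) then (p.1, p.2 - 1)
  else (p.1 - 1, p.2)

theorem entry_left (T : Filling μ) (c : Cell μ) : T (leftCell c) = entry T (c.1.1, c.1.2 - 1) :=
  (entry_coe T (leftCell c)).symm

theorem entry_up (T : Filling μ) (c : Cell μ) : T (upCell c) = entry T (c.1.1 - 1, c.1.2) :=
  (entry_coe T (upCell c)).symm

theorem jtStarStep_eq (ω : Cell μ) (T : Filling μ) (c : Cell μ) :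
    jtStarStep ω T c =
      if ω.1.2 < c.1.2 ∧ (c.1.1 = 0 ∨
          entry T (c.1.1 - 1, c.1.2) + 1 < entry T (c.1.1, c.1.2 - 1)) then
        some (slide T c (leftCell c) (T (leftCell c) - 1), leftCell c)
      else if c.1.1 = 0 then none
      else some (slide T c (upCell c) (T (upCell c) + 1), upCell c) := by
  rw [← entry_left, ← entry_up]
  unfold jtStarStep
  by_cases hx : c.1.2 ≤ ω.1.2
  · simp [hx, not_lt.2 hx]
  · by_cases hy : c.1.1 = 0
    · simp [hx, hy, not_le.1 hx, WithBot.bot_lt_coe]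
    · simp only [hx, hy, if_false, false_or, not_le.1 hx, true_and]
      norm_cast

theorem jtStar_self (ω : Cell μ) (T : Filling μ) : jtStar ω T ω = some (T, [ω.1]) := by
  rw [jtStar, if_pos rfl]

theorem jtStar_of_none {ω : Cell μ} {T : Filling μ} {c : Cell μ} (hc : c ≠ ω)
    (h : jtStarStep ω T c = none) : jtStar ω T c = none := by
  rw [jtStar, if_neg hc]
  split <;> simp_all

theorem jtStar_of_some {ω : Cell μ} {T : Filling μ} {c : Cell μ} {p : Filling μ × Cell μ}
    (hc : c ≠ ω) (h : jtStarStep ω T c = some p) :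
    jtStar ω T c = (jtStar ω p.1 p.2).map fun r => (r.1, r.2 ++ [c.1]) := by
  rw [jtStar, if_neg hc]
  split <;> simp_all

/-- The backward path of `p` towards `ω`, listed from `ω` to `p`. -/
inductive BackPath (j : ℕ) (T : Filling μ) (ω : ℕ × ℕ) : ℕ × ℕ → List (ℕ × ℕ) → Prop
  | base : BackPath j T ω ω [ω]
  | step {p : ℕ × ℕ} {L : List (ℕ × ℕ)} : p ≠ ω → (p.1 ≠ 0 ∨ j < p.2) →
      BackPath j T ω (backStep j T p) L → BackPath j T ω p (L ++ [p])

theorem backStep_cases (j : ℕ) (T : Filling μ) (p : ℕ × ℕ) :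
    (backStep j T p = (p.1, p.2 - 1) ∧ j < p.2) ∨ backStep j T p = (p.1 - 1, p.2) := by
  unfold backStep
  split_ifs with h
  · exact Or.inl ⟨rfl, h.1⟩
  · exact Or.inr rfl

/-- The comparisons made along a backward path read only entries weakly above and to the left of the
current position, never the special entry itself. -/
theorem BackPath.congr {j : ℕ} {T T' : Filling μ} {ω p : ℕ × ℕ} {L : List (ℕ × ℕ)}
    (h : BackPath j T ω p L)
    (hT : ∀ q : ℕ × ℕ, q.1 ≤ p.1 → q.2 ≤ p.2 → q ≠ p → entry T' q = entry T q) :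
    BackPath j T' ω p L := by
  induction h with
  | base => exact .base
  | @step p L hp h0 _ ih =>
    have key : backStep j T' p = backStep j T p := by
      unfold backStep
      by_cases h1 : p.1 = 0
      · simp [h1]
      · by_cases h2 : j < p.2
        · rw [hT (p.1 - 1, p.2) (by simp) le_rfl fun h => by
              have := congrArg Prod.fst h
              simp only at this
              omega,
            hT (p.1, p.2 - 1) le_rfl (by simp) fun h => by
              have := congrArg Prod.snd h
              simp only at this
              omega]
        · simp [h2]
    refine .step hp h0 ?_
    rw [key]
    refine ih fun q h1 h2 h3 => ?_
    rcases backStep_cases j T p with ⟨h, hj⟩ | h <;> rw [h] at h1 h2 h3 <;> simp only at h1 h2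
    · exact hT q h1 (by omega) (by rintro rfl; omega)
    · refine hT q (by omega) h2 ?_
      rintro rfl
      exact h3 (Prod.ext (by simp only; omega) rfl)

theorem slide_agree (T : Filling μ) (c d : Cell μ) (v : ℤ) (hd : d.1.1 + d.1.2 < c.1.1 + c.1.2)
    (q : ℕ × ℕ) (h1 : q.1 ≤ d.1.1) (h2 : q.2 ≤ d.1.2) (h3 : q ≠ d.1) :
    entry (slide T c d v) q = entry T q := by
  rw [entry_slide, if_neg h3, if_neg]
  rintro rfl
  omega

/-- `jtStar` changes the filling while it moves, whereas `BackPath` reads the original one. A slide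
alters only the cell just left and the new special cell, and no later comparison reads either of
them. -/
theorem jtStar_iff (ω : Cell μ) (T : Filling μ) (c : Cell μ) (L : List (ℕ × ℕ)) :
    (∃ T', jtStar ω T c = some (T', L)) ↔ BackPath ω.1.2 T ω.1 c.1 L := by
  induction hn : c.1.1 + c.1.2 using Nat.strong_induction_on generalizing T c L with
  | _ n ih =>
  subst hn
  by_cases hc : c = ω
  · subst hc
    rw [jtStar_self]
    constructor
    · rintro ⟨T', h⟩
      simp only [Option.some.injEq, Prod.mk.injEq] at h
      rw [← h.2]
      exact .base
    · intro h
      cases h with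
      | base => exact ⟨T, rfl⟩
      | step h => exact absurd rfl h
  · have hc' : c.1 ≠ ω.1 := fun h => hc (Subtype.ext h)
    cases hs : jtStarStep ω T c with
    | none =>
      rw [jtStar_of_none hc hs]
      rw [jtStarStep_eq] at hs
      split_ifs at hs with h1 h2
      constructor
      · rintro ⟨T', h⟩
        exact absurd h (by simp)
      · intro h
        generalize hq : c.1 = q at h
        cases h with
        | base => exact absurd hq hc'
        | step _ h0 => grind
    | some p =>
      rw [jtStar_of_some hc hs]
      have hlt := jtStarStep_lt hs
      have hp : p.2.1 = backStep ω.1.2 T c.1 ∧ (c.1.1 ≠ 0 ∨ ω.1.2 < c.1.2) ∧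
          ∃ v, p.1 = slide T c p.2 v := by
        rw [jtStarStep_eq] at hs
        unfold backStep
        split_ifs at hs ⊢ with h1 h2
        · simp only [Option.some.injEq] at hs
          subst hs
          exact ⟨rfl, Or.inr h1.1, _, rfl⟩
        · simp only [Option.some.injEq] at hs
          subst hs
          exact ⟨rfl, Or.inl h2, _, rfl⟩
      obtain ⟨hp1, hp2, v, hv⟩ := hp
      have agree : ∀ q : ℕ × ℕ, q.1 ≤ p.2.1.1 → q.2 ≤ p.2.1.2 → q ≠ p.2.1 →
          entry p.1 q = entry T q := by
        rw [hv]
        exact slide_agree T c p.2 v hlt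
      constructor
      · rintro ⟨T', h⟩
        simp only [Option.map_eq_some_iff, Prod.mk.injEq] at h
        obtain ⟨⟨T'', L'⟩, h1, h2, h3⟩ := h
        have := (ih _ hlt p.1 p.2 L' rfl).1 ⟨_, h1⟩
        simp only at h3
        rw [← h3]
        refine .step hc' hp2 ?_
        rw [← hp1]
        exact this.congr fun q a b c => (agree q a b c).symm
      · intro h
        generalize hq : c.1 = q at h
        cases h with
        | base => exact absurd hq hc'
        | @step _ L' _ _ h =>
          rw [← hq, ← hp1] at h
          obtain ⟨T', h'⟩ := (ih _ hlt p.1 p.2 L' rfl).2 (h.congr agree)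
          rw [h']
          exact ⟨T', by simp⟩

theorem BackPath.unique {j : ℕ} {T : Filling μ} {ω p : ℕ × ℕ} {L L' : List (ℕ × ℕ)}
    (h : BackPath j T ω p L) (h' : BackPath j T ω p L') : L = L' := by
  induction h generalizing L' with
  | base =>
    cases h' with
    | base => rfl
    | step h => exact absurd rfl h
  | step hp _ _ ih =>
    cases h' with
    | base => exact absurd rfl hp
    | step _ _ h => rw [ih h]

theorem BackPath.le {j : ℕ} {T : Filling μ} {ω p : ℕ × ℕ} {L : List (ℕ × ℕ)}
    (h : BackPath j T ω p L) : ω.1 ≤ p.1 ∧ ω.2 ≤ p.2 := by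
  induction h with
  | base => exact ⟨le_rfl, le_rfl⟩
  | @step p _ _ _ _ ih =>
    rcases backStep_cases j T p with ⟨h, _⟩ | h <;> rw [h] at ih <;> simp only at ih <;> omega

theorem BackPath.exists_concat {j : ℕ} {T : Filling μ} {ω p : ℕ × ℕ} {L : List (ℕ × ℕ)}
    (h : BackPath j T ω p L) : ∃ M, L = M ++ [p] := by
  cases h with
  | base => exact ⟨[], rfl⟩
  | @step _ L => exact ⟨L, rfl⟩

/-! ### Partially sorted fillings with one special entry. -/

/-- The cells at or after `(i, j)` in the column-by-column order. -/
def Act (i j r c : ℕ) : Prop := j < c ∨ (c = j ∧ i ≤ r)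

/-- The part of the filling at or after `(i, j)` is a semistandard tableau. -/
structure Ordered (i j : ℕ) (T : Filling μ) : Prop where
  row : ∀ a b, Act i j a b → (a, b + 1) ∈ μ → entry T (a, b) ≤ entry T (a, b + 1)
  col : ∀ a b, Act i j a b → (a + 1, b) ∈ μ → entry T (a, b) < entry T (a + 1, b)

/-- The special entry is in `(r, c)`: the other entries are ordered, the special entry is
compatible with its left and upper neighbours, and any neighbour may be moved into `(r, c)`. -/
structure Hole (i j : ℕ) (T : Filling μ) (r c : ℕ) : Prop where
  row : ∀ a b, Act i j a b → (a, b + 1) ∈ μ → (a, b) ≠ (r, c) → (a, b + 1) ≠ (r, c) →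
    entry T (a, b) ≤ entry T (a, b + 1)
  col : ∀ a b, Act i j a b → (a + 1, b) ∈ μ → (a, b) ≠ (r, c) → (a + 1, b) ≠ (r, c) →
    entry T (a, b) < entry T (a + 1, b)
  left : ∀ b, c = b + 1 → Act i j r b → entry T (r, b) ≤ entry T (r, c)
  up : ∀ a, r = a + 1 → Act i j a c → entry T (a, c) < entry T (r, c)
  left_right : ∀ b, c = b + 1 → Act i j r b → (r, c + 1) ∈ μ →
    entry T (r, b) ≤ entry T (r, c + 1) + 1
  left_below : ∀ b, c = b + 1 → Act i j r b → (r + 1, c) ∈ μ → entry T (r, b) < entry T (r + 1, c)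
  up_right : ∀ a, r = a + 1 → Act i j a c → (r, c + 1) ∈ μ → entry T (a, c) ≤ entry T (r, c + 1)
  up_below : ∀ a, r = a + 1 → Act i j a c → (r + 1, c) ∈ μ →
    entry T (a, c) + 1 < entry T (r + 1, c)

theorem Act.right {i j r c : ℕ} (h : Act i j r c) : Act i j r (c + 1) := by
  unfold Act at *; omega

theorem Act.down {i j r c : ℕ} (h : Act i j r c) : Act i j (r + 1) c := by
  unfold Act at *; omega

/-- Go right along row `r`, then down column `c'`; every step down gains at least one. -/
theorem Ordered.le {i j r c r' c' : ℕ} {T : Filling μ} (h : Ordered i j T) (ha : Act i j r c)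
    (hm : (r', c') ∈ μ) (hr : r ≤ r') (hc : c ≤ c') :
    entry T (r, c) + ((r' : ℤ) - r) ≤ entry T (r', c') := by
  have h1 : ∀ n, (r, c + n) ∈ μ → entry T (r, c) ≤ entry T (r, c + n) := by
    intro n
    induction n with
    | zero => intro _; exact le_rfl
    | succ n ih =>
      intro hn
      refine (ih (mem_of_le hn le_rfl (by omega))).trans (h.row r (c + n) ?_ hn)
      unfold Act at *; omega
  have h2 : ∀ n, (r + n, c') ∈ μ → entry T (r, c') + n ≤ entry T (r + n, c') := by
    intro n
    induction n with
    | zero => intro _; simp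
    | succ n ih =>
      intro hn
      have h3 := ih (mem_of_le hn (by omega) le_rfl)
      have h4 := h.col (r + n) c' (by unfold Act at *; omega) hn
      rw [← add_assoc]
      push_cast
      omega
  obtain ⟨n, rfl⟩ := Nat.exists_eq_add_of_le hr
  obtain ⟨m, rfl⟩ := Nat.exists_eq_add_of_le hc
  have h3 := h1 m (mem_of_le hm (by omega) le_rfl)
  have h4 := h2 n hm
  push_cast
  omega

/-- The left and upper neighbours of `(i, j)` precede it in the order of the cells, so all
conditions on them are vacuous. -/
theorem Hole.of_ordered_succ {i j : ℕ} {T : Filling μ} (h : Ordered (i + 1) j T) :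
    Hole i j T i j where
  row a b ha hm h1 _ := h.row a b (by unfold Act at *; grind) hm
  col a b ha hm h1 _ := h.col a b (by unfold Act at *; grind) hm
  left b hb ha := by unfold Act at ha; omega
  up b hb ha := by unfold Act at ha; omega
  left_right b hb ha := by unfold Act at ha; omega
  left_below b hb ha := by unfold Act at ha; omega
  up_right b hb ha := by unfold Act at ha; omega
  up_below b hb ha := by unfold Act at ha; omega

theorem Hole.ordered_succ {i j : ℕ} {T : Filling μ} (h : Hole i j T i j) :
    Ordered (i + 1) j T where
  row a b ha hm := h.row a b (by unfold Act at *; omega) hm (by unfold Act at ha; grind)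
    (by unfold Act at ha; grind)
  col a b ha hm := h.col a b (by unfold Act at *; omega) hm (by unfold Act at ha; grind)
    (by unfold Act at ha; grind)

/-- Starting point of a backward slide: in a tableau, any entry may be declared special. -/
theorem Hole.of_ordered {i j r c : ℕ} {T : Filling μ} (h : Ordered i j T) (hm : (r, c) ∈ μ) :
    Hole i j T r c := by
  have hl : ∀ b, c = b + 1 → Act i j r b → entry T (r, b) ≤ entry T (r, c) := by
    rintro b rfl ha
    exact h.row r b ha hm
  have hu : ∀ a, r = a + 1 → Act i j a c → entry T (a, c) < entry T (r, c) := by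
    rintro a rfl ha
    exact h.col a c ha hm
  refine ⟨fun a b ha hm _ _ => h.row a b ha hm, fun a b ha hm _ _ => h.col a b ha hm, hl, hu,
    fun b hb ha hx => ?_, fun b hb ha hx => ?_, fun b hb ha hx => ?_, fun b hb ha hx => ?_⟩
  · have := hl b hb ha
    have := h.row r c (by unfold Act at *; omega) hx
    omega
  · have := hl b hb ha
    have := h.col r c (by unfold Act at *; omega) hx
    omega
  · have := hu b hb ha
    have := h.row r c (by unfold Act at *; omega) hx
    omega
  · have := hu b hb ha
    have := h.col r c (by unfold Act at *; omega) hx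
    omega

theorem Hole.ordered {i j r c : ℕ} {T : Filling μ} (h : Hole i j T r c)
    (hx : (r, c + 1) ∈ μ → entry T (r, c) ≤ entry T (r, c + 1))
    (hy : (r + 1, c) ∈ μ → entry T (r, c) < entry T (r + 1, c)) : Ordered i j T where
  row a b ha hm := by
    by_cases h1 : (a, b) = (r, c)
    · obtain ⟨rfl, rfl⟩ := Prod.mk.inj h1
      exact hx hm
    by_cases h2 : (a, b + 1) = (r, c)
    · obtain ⟨rfl, rfl⟩ := Prod.mk.inj h2
      exact h.left b rfl ha
    exact h.row a b ha hm h1 h2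
  col a b ha hm := by
    by_cases h1 : (a, b) = (r, c)
    · obtain ⟨rfl, rfl⟩ := Prod.mk.inj h1
      exact hy hm
    by_cases h2 : (a + 1, b) = (r, c)
    · obtain ⟨rfl, rfl⟩ := Prod.mk.inj h2
      exact h.up a rfl ha
    exact h.col a b ha hm h1 h2

/-- The entry `x` that fills the hole becomes `x + 1`. Against its new left and upper neighbours
this is covered by `left_right` and `up_right`, against its new lower neighbour by the rule `hy`. -/
theorem Hole.move_right {i j r c : ℕ} {T T' : Filling μ} (h : Hole i j T r c)
    (ha : Act i j r c) (hm : (r, c + 1) ∈ μ)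
    (e1 : entry T' (r, c) = entry T (r, c + 1) + 1) (e2 : entry T' (r, c + 1) = entry T (r, c))
    (e3 : ∀ a b, (a, b) ≠ (r, c) → (a, b) ≠ (r, c + 1) → entry T' (a, b) = entry T (a, b))
    (hx : entry T (r, c + 1) < entry T (r, c))
    (hy : (r + 1, c) ∈ μ → entry T (r, c + 1) + 1 < entry T (r + 1, c)) :
    Hole i j T' r (c + 1) where
  row a b hab hm' h1 h2 := by
    by_cases h4 : (a, b + 1) = (r, c)
    · obtain ⟨rfl, rfl⟩ := Prod.mk.inj h4
      rw [e1, e3 _ _ (by grind) (by grind)]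
      exact h.left_right b rfl hab hm
    · rw [e3 a b (by grind) h1, e3 a (b + 1) h4 h2]
      exact h.row a b hab hm' (by grind) h4
  col a b hab hm' h1 h2 := by
    by_cases h3 : (a, b) = (r, c)
    · obtain ⟨rfl, rfl⟩ := Prod.mk.inj h3
      rw [e1, e3 _ _ (by grind) (by grind)]
      exact hy hm'
    by_cases h4 : (a + 1, b) = (r, c)
    · obtain ⟨rfl, rfl⟩ := Prod.mk.inj h4
      rw [e1, e3 _ _ (by grind) (by grind)]
      have := h.up_right a rfl hab hm
      omega
    · rw [e3 a b h3 h1, e3 (a + 1) b h4 h2]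
      exact h.col a b hab hm' h3 h4
  left b hb _ := by
    obtain rfl : b = c := by omega
    rw [e1, e2]; omega
  up a hra hab := by
    subst hra
    rw [e2, e3 _ _ (by grind) (by grind)]
    have := h.col a (c + 1) hab hm (by grind) (by grind)
    omega
  left_right b hb _ hm' := by
    obtain rfl : b = c := by omega
    rw [e1, e3 _ _ (by grind) (by grind)]
    have := h.row r (b + 1) ha.right hm' (by grind) (by grind)
    omega
  left_below b hb _ hm' := by
    obtain rfl : b = c := by omega
    rw [e1, e3 _ _ (by grind) (by grind)]
    have h1 := hy (mem_of_le hm' le_rfl (by omega))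
    have := h.row (r + 1) b ha.down hm' (by grind) (by grind)
    omega
  up_right a hra hab hm' := by
    subst hra
    rw [e3 _ _ (by grind) (by grind), e3 _ _ (by grind) (by grind)]
    have := h.col a (c + 1) hab hm (by grind) (by grind)
    have := h.row (a + 1) (c + 1) ha.right hm' (by grind) (by grind)
    omega
  up_below a hra hab hm' := by
    subst hra
    rw [e3 _ _ (by grind) (by grind), e3 _ _ (by grind) (by grind)]
    have := h.col a (c + 1) hab hm (by grind) (by grind)
    have := h.col (a + 1) (c + 1) ha.right hm' (by grind) (by grind)
    omega

/-- The entry `y` that fills the hole becomes `y - 1`; `left_below` and `up_below` compare it with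
the entries to the left and above, the rule `hx` with the entry to the right. -/
theorem Hole.move_down {i j r c : ℕ} {T T' : Filling μ} (h : Hole i j T r c)
    (ha : Act i j r c) (hm : (r + 1, c) ∈ μ)
    (e1 : entry T' (r, c) = entry T (r + 1, c) - 1) (e2 : entry T' (r + 1, c) = entry T (r, c))
    (e3 : ∀ a b, (a, b) ≠ (r, c) → (a, b) ≠ (r + 1, c) → entry T' (a, b) = entry T (a, b))
    (hy : entry T (r + 1, c) ≤ entry T (r, c))
    (hx : (r, c + 1) ∈ μ → entry T (r + 1, c) ≤ entry T (r, c + 1) + 1) :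
    Hole i j T' (r + 1) c where
  row a b hab hm' h1 h2 := by
    by_cases h3 : (a, b) = (r, c)
    · obtain ⟨rfl, rfl⟩ := Prod.mk.inj h3
      rw [e1, e3 _ _ (by grind) (by grind)]
      have := hx hm'
      omega
    by_cases h4 : (a, b + 1) = (r, c)
    · obtain ⟨rfl, rfl⟩ := Prod.mk.inj h4
      rw [e1, e3 _ _ (by grind) (by grind)]
      have := h.left_below b rfl hab hm
      omega
    · rw [e3 a b h3 h1, e3 a (b + 1) h4 h2]
      exact h.row a b hab hm' h3 h4
  col a b hab hm' h1 h2 := by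
    by_cases h4 : (a + 1, b) = (r, c)
    · obtain ⟨rfl, rfl⟩ := Prod.mk.inj h4
      rw [e1, e3 _ _ (by grind) (by grind)]
      have := h.up_below a rfl hab hm
      omega
    · rw [e3 a b (by grind) h1, e3 (a + 1) b h4 h2]
      exact h.col a b hab hm' (by grind) h4
  left b hb hab := by
    subst hb
    rw [e2, e3 _ _ (by grind) (by grind)]
    have := h.row (r + 1) b hab hm (by grind) (by grind)
    omega
  up a hra _ := by
    obtain rfl : a = r := by omega
    rw [e1, e2]; omega
  left_right b hb hab hm' := by
    subst hb
    rw [e3 _ _ (by grind) (by grind), e3 _ _ (by grind) (by grind)]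
    have := h.row (r + 1) b hab hm (by grind) (by grind)
    have := h.row (r + 1) (b + 1) ha.down hm' (by grind) (by grind)
    omega
  left_below b hb hab hm' := by
    subst hb
    rw [e3 _ _ (by grind) (by grind), e3 _ _ (by grind) (by grind)]
    have := h.row (r + 1) b hab hm (by grind) (by grind)
    have := h.col (r + 1) (b + 1) ha.down hm' (by grind) (by grind)
    omega
  up_right a hra _ hm' := by
    obtain rfl : a = r := by omega
    rw [e1, e3 _ _ (by grind) (by grind)]
    have := h.row (a + 1) c ha.down hm' (by grind) (by grind)
    omega
  up_below a hra _ hm' := by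
    obtain rfl : a = r := by omega
    rw [e1, e3 _ _ (by grind) (by grind)]
    have := h.col (a + 1) c ha.down hm' (by grind) (by grind)
    omega

/-- Now the left neighbour `x` fills the hole as `x - 1`: `left_right` and `left_below` compare it
with the entries to the right and below, `hu` with the entry above. -/
theorem Hole.move_left {i j r c : ℕ} {T T' : Filling μ} (h : Hole i j T r (c + 1))
    (ha : Act i j r c) (hm : (r, c + 1) ∈ μ)
    (e1 : entry T' (r, c + 1) = entry T (r, c) - 1) (e2 : entry T' (r, c) = entry T (r, c + 1))
    (e3 : ∀ a b, (a, b) ≠ (r, c) → (a, b) ≠ (r, c + 1) → entry T' (a, b) = entry T (a, b))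
    (hu : ∀ a, r = a + 1 → entry T (a, c + 1) + 1 < entry T (r, c)) :
    Hole i j T' r c where
  row a b hab hm' h1 h2 := by
    by_cases h3 : (a, b) = (r, c + 1)
    · obtain ⟨rfl, rfl⟩ := Prod.mk.inj h3
      rw [e1, e3 _ _ (by grind) (by grind)]
      have := h.left_right c rfl ha hm'
      omega
    · rw [e3 a b h1 h3, e3 a (b + 1) h2 (by grind)]
      exact h.row a b hab hm' h3 (by grind)
  col a b hab hm' h1 h2 := by
    by_cases h3 : (a, b) = (r, c + 1)
    · obtain ⟨rfl, rfl⟩ := Prod.mk.inj h3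
      rw [e1, e3 _ _ (by grind) (by grind)]
      have := h.left_below c rfl ha hm'
      omega
    by_cases h4 : (a + 1, b) = (r, c + 1)
    · obtain ⟨rfl, rfl⟩ := Prod.mk.inj h4
      rw [e1, e3 _ _ (by grind) (by grind)]
      have := hu a rfl
      omega
    · rw [e3 a b h1 h3, e3 (a + 1) b h2 h4]
      exact h.col a b hab hm' h3 h4
  left b hb hab := by
    subst hb
    rw [e2, e3 _ _ (by grind) (by grind)]
    have := h.row r b hab (mem_of_le hm le_rfl (by omega)) (by grind) (by grind)
    have := h.left (b + 1) rfl ha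
    omega
  up a hra hab := by
    subst hra
    rw [e2, e3 _ _ (by grind) (by grind)]
    have := h.col a c hab (mem_of_le hm le_rfl (by omega)) (by grind) (by grind)
    have := h.left c rfl ha
    omega
  left_right b hb hab hm' := by
    subst hb
    rw [e1, e3 _ _ (by grind) (by grind)]
    have := h.row r b hab (mem_of_le hm le_rfl (by omega)) (by grind) (by grind)
    omega
  left_below b hb hab hm' := by
    subst hb
    rw [e3 _ _ (by grind) (by grind), e3 _ _ (by grind) (by grind)]
    have := h.row r b hab (mem_of_le hm le_rfl (by omega)) (by grind) (by grind)
    have := h.col r (b + 1) ha hm' (by grind) (by grind)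
    omega
  up_right a hra hab hm' := by
    subst hra
    rw [e1, e3 _ _ (by grind) (by grind)]
    have := h.col a c hab (mem_of_le hm le_rfl (by omega)) (by grind) (by grind)
    omega
  up_below a hra hab hm' := by
    subst hra
    rw [e3 _ _ (by grind) (by grind), e3 _ _ (by grind) (by grind)]
    have := h.col a c hab (mem_of_le hm le_rfl (by omega)) (by grind) (by grind)
    have := h.col (a + 1) c ha hm' (by grind) (by grind)
    omega

/-- The upper neighbour `y` fills the hole as `y + 1`, which fits above by `up_below` and to the
left by `hl`. It fits on the right because column `c + 1` is strict: the entry there exceeds its own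
upper neighbour, which is at least `y`. -/
theorem Hole.move_up {i j r c : ℕ} {T T' : Filling μ} (h : Hole i j T (r + 1) c)
    (ha : Act i j r c) (hm : (r + 1, c) ∈ μ)
    (e1 : entry T' (r + 1, c) = entry T (r, c) + 1) (e2 : entry T' (r, c) = entry T (r + 1, c))
    (e3 : ∀ a b, (a, b) ≠ (r, c) → (a, b) ≠ (r + 1, c) → entry T' (a, b) = entry T (a, b))
    (hl : ∀ b, c = b + 1 → j ≤ b → entry T (r + 1, b) ≤ entry T (r, c) + 1) :
    Hole i j T' r c where
  row a b hab hm' h1 h2 := by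
    by_cases h3 : (a, b) = (r + 1, c)
    · obtain ⟨rfl, rfl⟩ := Prod.mk.inj h3
      rw [e1, e3 _ _ (by grind) (by grind)]
      have := h.row r b ha (mem_of_le hm' (by omega) le_rfl) (by grind) (by grind)
      have := h.col r (b + 1) ha.right hm' (by grind) (by grind)
      omega
    by_cases h4 : (a, b + 1) = (r + 1, c)
    · obtain ⟨rfl, rfl⟩ := Prod.mk.inj h4
      rw [e1, e3 _ _ (by grind) (by grind)]
      exact hl b rfl (by unfold Act at hab; omega)
    · rw [e3 a b h1 h3, e3 a (b + 1) h2 h4]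
      exact h.row a b hab hm' h3 h4
  col a b hab hm' h1 h2 := by
    by_cases h3 : (a, b) = (r + 1, c)
    · obtain ⟨rfl, rfl⟩ := Prod.mk.inj h3
      rw [e1, e3 _ _ (by grind) (by grind)]
      exact h.up_below r rfl ha hm'
    · rw [e3 a b h1 h3, e3 (a + 1) b h2 (by grind)]
      exact h.col a b hab hm' h3 (by grind)
  left b hb hab := by
    subst hb
    rw [e2, e3 _ _ (by grind) (by grind)]
    have := h.row r b hab (mem_of_le hm (by omega) le_rfl) (by grind) (by grind)
    have := h.up r rfl ha
    omega
  up a hra hab := by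
    subst hra
    rw [e2, e3 _ _ (by grind) (by grind)]
    have := h.col a c hab (mem_of_le hm (by omega) le_rfl) (by grind) (by grind)
    have := h.up (a + 1) rfl ha
    omega
  left_right b hb hab hm' := by
    subst hb
    rw [e3 _ _ (by grind) (by grind), e3 _ _ (by grind) (by grind)]
    have := h.row r b hab (mem_of_le hm (by omega) le_rfl) (by grind) (by grind)
    have := h.row r (b + 1) ha hm' (by grind) (by grind)
    omega
  left_below b hb hab hm' := by
    subst hb
    rw [e1, e3 _ _ (by grind) (by grind)]
    have := h.row r b hab (mem_of_le hm (by omega) le_rfl) (by grind) (by grind)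
    omega
  up_right a hra hab hm' := by
    subst hra
    rw [e3 _ _ (by grind) (by grind), e3 _ _ (by grind) (by grind)]
    have := h.col a c hab (mem_of_le hm (by omega) le_rfl) (by grind) (by grind)
    have := h.row (a + 1) c ha hm' (by grind) (by grind)
    omega
  up_below a hra hab hm' := by
    subst hra
    rw [e1, e3 _ _ (by grind) (by grind)]
    have := h.col a c hab (mem_of_le hm (by omega) le_rfl) (by grind) (by grind)
    omega

/-! ### The sliding path and its coding by `top`. -/

/-- `T'` arises from `T` by moving the entry in `(r₀, c₀)` to `(r₁, c₁)` along a path to the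
right/bottom. The path consists of the cells in rows `top c, …, top (c + 1)` of the columns
`c` with `c₀ ≤ c ≤ c₁`. -/
structure Shift (T T' : Filling μ) (r₀ c₀ r₁ c₁ : ℕ) (top : ℕ → ℕ) : Prop where
  mono : Monotone top
  before : ∀ c, c ≤ c₀ → top c = r₀
  after : ∀ c, c₁ < c → top c = r₁
  le : c₀ ≤ c₁
  off : ∀ r c, ¬ (c₀ ≤ c ∧ c ≤ c₁ ∧ top c ≤ r ∧ r ≤ top (c + 1)) → entry T' (r, c) = entry T (r, c)
  down : ∀ r c, c₀ ≤ c → c ≤ c₁ → top c ≤ r → r < top (c + 1) →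
    entry T' (r, c) = entry T (r + 1, c) - 1
  right : ∀ c, c₀ ≤ c → c < c₁ → entry T' (top (c + 1), c) = entry T (top (c + 1), c + 1) + 1
  last : entry T' (r₁, c₁) = entry T (r₀, c₀)

theorem Shift.refl (T : Filling μ) (r c : ℕ) : Shift T T r c r c fun _ => r where
  mono := monotone_const
  before _ _ := rfl
  after _ _ := rfl
  le := le_rfl
  off _ _ _ := rfl
  down _ _ _ _ _ _ := by omega
  right _ _ _ := by omega
  last := rfl

/-- A right step in front keeps `top`, whose value is `r` up to column `c + 1` anyway. -/
theorem Shift.of_right {T T₁ T' : Filling μ} {r c r₁ c₁ : ℕ} {top : ℕ → ℕ}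
    (h : Shift T₁ T' r (c + 1) r₁ c₁ top)
    (e1 : entry T₁ (r, c) = entry T (r, c + 1) + 1) (e2 : entry T₁ (r, c + 1) = entry T (r, c))
    (e3 : ∀ a b, (a, b) ≠ (r, c) → (a, b) ≠ (r, c + 1) → entry T₁ (a, b) = entry T (a, b)) :
    Shift T T' r c r₁ c₁ top := by
  have t0 := h.before c (by omega)
  have t1 := h.before (c + 1) le_rfl
  have t2 : top (c + 1) ≤ top (c + 1 + 1) := h.mono (by omega)
  have hle := h.le
  refine ⟨h.mono, fun x hx => h.before x (by omega), h.after, by omega, fun a b hab => ?_,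
    fun a b h1 h2 h3 h4 => ?_, fun b h1 h2 => ?_, ?_⟩
  · rw [h.off a b fun ⟨h1, h2, h3, h4⟩ => hab ⟨by omega, h2, h3, h4⟩]
    refine e3 a b ?_ ?_ <;> rintro ⟨⟩ <;> apply hab <;> refine ⟨?_, ?_, ?_, ?_⟩ <;> omega
  · by_cases hb : b = c
    · subst hb; omega
    · rw [h.down a b (by omega) h2 h3 h4, e3 (a + 1) b (by grind) (by grind)]
  · by_cases hb : b = c
    · subst hb
      rw [h.off _ _ (by omega), t1, e1]
    · rw [h.right b (by omega) h2, e3 _ (b + 1) (by grind) (by grind)]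
  · rw [h.last, e2]

/-- A down step in front changes `top` from `r + 1` to `r` up to column `c` and leaves the later
columns alone. -/
theorem Shift.of_down {T T₁ T' : Filling μ} {r c r₁ c₁ : ℕ} {top top' : ℕ → ℕ}
    (h : Shift T₁ T' (r + 1) c r₁ c₁ top)
    (low : ∀ x, x ≤ c → top' x = r) (high : ∀ x, c < x → top' x = top x)
    (e1 : entry T₁ (r, c) = entry T (r + 1, c) - 1) (e2 : entry T₁ (r + 1, c) = entry T (r, c))
    (e3 : ∀ a b, (a, b) ≠ (r, c) → (a, b) ≠ (r + 1, c) → entry T₁ (a, b) = entry T (a, b)) :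
    Shift T T' r c r₁ c₁ top' := by
  have t0 := h.before c le_rfl
  have t1 := low c le_rfl
  have hle := h.le
  have ge : ∀ x, r + 1 ≤ top x := fun x => by
    rcases le_total x c with hx | hx
    · exact (h.before x hx).ge
    · exact t0 ▸ h.mono hx
  refine ⟨fun x y hxy => ?_, low, fun x hx => ?_, by omega, fun a b hab => ?_,
    fun a b h1 h2 h3 h4 => ?_, fun b h1 h2 => ?_, ?_⟩
  · have := h.mono hxy
    have := ge y
    rcases le_or_gt x c with hx | hx
    · rw [low x hx]
      rcases le_or_gt y c with hy | hy
      · rw [low y hy]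
      · rw [high y hy]; omega
    · rw [high x hx, high y (by omega)]; exact h.mono hxy
  · rw [high x (by omega), h.after x hx]
  · have t2 := high (c + 1) (by omega)
    have t3 := ge (c + 1)
    rw [h.off a b fun ⟨h1, h2, h3, h4⟩ => hab ⟨h1, h2, ?_, ?_⟩]
    · refine e3 a b ?_ ?_ <;> rintro ⟨⟩ <;> apply hab <;> refine ⟨?_, ?_, ?_, ?_⟩ <;> omega
    · rcases Nat.eq_or_lt_of_le h1 with rfl | h5
      · omega
      · rw [high b h5]; exact h3
    · rw [high (b + 1) (by omega)]; exact h4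
  · rw [high (b + 1) (by omega)] at h4
    rcases Nat.eq_or_lt_of_le h1 with rfl | h5
    · by_cases ha : a = r
      · subst ha
        rw [h.off _ _ (by omega), e1]
      · rw [h.down a _ le_rfl h2 (by omega) h4, e3 (a + 1) _ (by grind) (by grind)]
    · rw [high b h5] at h3
      rw [h.down a b h1 h2 h3 h4, e3 (a + 1) b (by grind) (by grind)]
  · rw [high (b + 1) (by omega), h.right b h1 h2, e3 _ (b + 1) (by grind) (by grind)]
  · rw [h.last, e2]

/-! ### Forward and backward slides undo each other. -/

/-- The upper neighbour `y` of `d` is smaller than the old entry `x` of `d`, and the left neighbour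
has become `x + 1`. So `y + 1 < x + 1`, and the backward rule chooses left. -/
theorem jtStarStep_slide_right {i j : ℕ} {ω : Cell μ} (hω : ω.1 = (i, j)) {T : Filling μ}
    {c d : Cell μ} (hd : d.1 = (c.1.1, c.1.2 + 1)) (ha : Act i j c.1.1 c.1.2)
    (h : Hole i j T c.1.1 c.1.2) :
    jtStarStep ω (slide T c d (T d + 1)) d = some (T, c) := by
  have hcd : c ≠ d := fun h => by
    have := congrArg (fun x : Cell μ => x.1.2) h
    simp only [hd] at this
    omega
  have hl : leftCell d = c := Subtype.ext (by simp [leftCell, hd])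
  have hdm : (c.1.1, c.1.2 + 1) ∈ μ := (YoungDiagram.mem_cells _).1 (hd ▸ d.2)
  rw [jtStarStep_eq, if_pos]
  · rw [hl, slide_slide T c d]
    simp [slide, hcd]
  · refine ⟨by rw [hω, hd]; unfold Act at ha; simp only; omega, ?_⟩
    rcases Nat.eq_zero_or_eq_succ_pred d.1.1 with h0 | h0
    · exact Or.inl h0
    · right
      rw [hd] at h0 ⊢
      simp only [Nat.add_sub_cancel] at h0 ⊢
      rw [entry_slide, entry_slide, hd, if_neg (by grind), if_neg (by grind), if_neg (by grind),
        if_pos rfl, ← entry_coe T d, hd]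
      have := h.col (c.1.1 - 1) (c.1.2 + 1) (by unfold Act at *; omega) (by grind) (by grind)
        (by grind)
      grind

/-- The left neighbour of `d` is at most the old entry `y` of `d`, and the upper neighbour has
become `y - 1`. So the backward rule chooses up. -/
theorem jtStarStep_slide_down {i j : ℕ} {ω : Cell μ} (hω : ω.1 = (i, j)) {T : Filling μ}
    {c d : Cell μ} (hd : d.1 = (c.1.1 + 1, c.1.2)) (hi : i ≤ c.1.1)
    (h : Hole i j T c.1.1 c.1.2) :
    jtStarStep ω (slide T c d (T d - 1)) d = some (T, c) := by
  have hcd : c ≠ d := fun h => by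
    have := congrArg (fun x : Cell μ => x.1.1) h
    simp only [hd] at this
    omega
  have hu : upCell d = c := Subtype.ext (by simp [upCell, hd])
  have hdm : (c.1.1 + 1, c.1.2) ∈ μ := (YoungDiagram.mem_cells _).1 (hd ▸ d.2)
  rw [jtStarStep_eq, if_neg, if_neg (by simp [hd])]
  · rw [hu, slide_slide T c d]
    simp [slide, hcd]
  · rw [hω, hd]
    rintro ⟨h1, h2⟩
    simp only [Nat.add_sub_cancel] at h1 h2
    rcases h2 with h2 | h2
    · omega
    rw [entry_slide, entry_slide, hd, if_neg (by grind), if_pos rfl, if_neg (by grind),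
      if_neg (by grind), ← entry_coe T d, hd] at h2
    have := h.row (c.1.1 + 1) (c.1.2 - 1) (by unfold Act at *; omega) (by grind) (by grind)
      (by grind)
    grind

/-- The last claim is relative to whatever backward result the current position has; in this form it
is passed on from step to step, because the first backward step from the new cell undoes the forward
step. -/
theorem forward_of_hole {i j : ℕ} {ω : Cell μ} (hω : ω.1 = (i, j)) (T : Filling μ) (c : Cell μ)
    (h : Hole i j T c.1.1 c.1.2) (hi : i ≤ c.1.1) (hj : j ≤ c.1.2) :
    Ordered i j (jt T c).1 ∧
    (∃ top, Shift T (jt T c).1 c.1.1 c.1.2 (jt T c).2.1.1 (jt T c).2.1.2 top) ∧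
    ∀ T₀ L₀, jtStar ω T c = some (T₀, L₀) → ∃ L, jtStar ω (jt T c).1 (jt T c).2 = some (T₀, L) := by
  induction hn : μ.colLen 0 + μ.rowLen 0 - (c.1.1 + c.1.2) using Nat.strong_induction_on
    generalizing T c with
  | _ n ih =>
  subst hn
  have ha : Act i j c.1.1 c.1.2 := by unfold Act; omega
  rcases jtStep_cases T c with ⟨h0, hx, hy⟩ | ⟨d, hd, hs, hx, hy⟩ | ⟨d, hd, hs, hy, hx⟩
  · rw [jt_of_none h0]
    exact ⟨h.ordered hx hy, ⟨_, Shift.refl T _ _⟩, fun T₀ L₀ h => ⟨L₀, h⟩⟩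
  · have hdm : (c.1.1, c.1.2 + 1) ∈ μ := (YoungDiagram.mem_cells _).1 (hd ▸ d.2)
    have e1 : entry (slide T c d (T d + 1)) (c.1.1, c.1.2) = entry T (c.1.1, c.1.2 + 1) + 1 := by
      rw [entry_slide, hd, if_neg (by grind), if_pos rfl, ← entry_coe T d, hd]
    have e2 : entry (slide T c d (T d + 1)) (c.1.1, c.1.2 + 1) = entry T (c.1.1, c.1.2) := by
      rw [entry_slide, hd, if_pos rfl, ← entry_coe T c]
    have e3 : ∀ a b, (a, b) ≠ (c.1.1, c.1.2) → (a, b) ≠ (c.1.1, c.1.2 + 1) →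
        entry (slide T c d (T d + 1)) (a, b) = entry T (a, b) := by
      intro a b h1 h2
      rw [entry_slide, hd, if_neg h2, if_neg h1]
    have hb := jtStarStep_slide_right hω hd ha h
    have hh := h.move_right ha hdm e1 e2 e3 hx hy
    have hlt := cell_lt d
    have hdω : d ≠ ω := by
      rintro rfl
      rw [hω] at hd
      unfold Act at ha
      grind
    rw [jt_of_some hs]
    have hd1 : d.1.1 = c.1.1 := by rw [hd]
    have hd2 : d.1.2 = c.1.2 + 1 := by rw [hd]
    obtain ⟨i1, ⟨top, i2⟩, i3⟩ := ih _ (by omega) (slide T c d (T d + 1)) d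
      (by rw [hd1, hd2]; exact hh) (by omega) (by omega) rfl
    refine ⟨i1, ⟨_, Shift.of_right (by rw [hd1, hd2] at i2; exact i2) e1 e2 e3⟩,
      fun T₀ L₀ h0 => i3 T₀ (L₀ ++ [d.1]) ?_⟩
    rw [jtStar_of_some hdω hb, h0]
    rfl
  · have hdm : (c.1.1 + 1, c.1.2) ∈ μ := (YoungDiagram.mem_cells _).1 (hd ▸ d.2)
    have e1 : entry (slide T c d (T d - 1)) (c.1.1, c.1.2) = entry T (c.1.1 + 1, c.1.2) - 1 := by
      rw [entry_slide, hd, if_neg (by grind), if_pos rfl, ← entry_coe T d, hd]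
    have e2 : entry (slide T c d (T d - 1)) (c.1.1 + 1, c.1.2) = entry T (c.1.1, c.1.2) := by
      rw [entry_slide, hd, if_pos rfl, ← entry_coe T c]
    have e3 : ∀ a b, (a, b) ≠ (c.1.1, c.1.2) → (a, b) ≠ (c.1.1 + 1, c.1.2) →
        entry (slide T c d (T d - 1)) (a, b) = entry T (a, b) := by
      intro a b h1 h2
      rw [entry_slide, hd, if_neg h2, if_neg h1]
    have hb := jtStarStep_slide_down hω hd hi h
    have hh := h.move_down ha hdm e1 e2 e3 hy hx
    have hlt := cell_lt d
    have hdω : d ≠ ω := by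
      rintro rfl
      rw [hω] at hd
      unfold Act at ha
      grind
    rw [jt_of_some hs]
    have hd1 : d.1.1 = c.1.1 + 1 := by rw [hd]
    have hd2 : d.1.2 = c.1.2 := by rw [hd]
    obtain ⟨i1, ⟨top, i2⟩, i3⟩ := ih _ (by omega) (slide T c d (T d - 1)) d
      (by rw [hd1, hd2]; exact hh) (by omega) (by omega) rfl
    refine ⟨i1, ⟨fun x => if x ≤ c.1.2 then c.1.1 else top x,
      Shift.of_down (by rw [hd1, hd2] at i2; exact i2)
      (fun x hx => if_pos hx) (fun x hx => if_neg (by omega)) e1 e2 e3⟩,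
      fun T₀ L₀ h0 => i3 T₀ (L₀ ++ [d.1]) ?_⟩
    rw [jtStar_of_some hdω hb, h0]
    rfl

/-- Forward jeu de taquin sorts the entry of the distinguished cell into the tableau formed by the
later cells, and is undone by backward jeu de taquin. -/
theorem forward_of_ordered {i j : ℕ} {ω : Cell μ} (hω : ω.1 = (i, j)) {T : Filling μ}
    (h : Ordered (i + 1) j T) :
    Ordered i j (jt T ω).1 ∧
    (∃ top, Shift T (jt T ω).1 i j (jt T ω).2.1.1 (jt T ω).2.1.2 top) ∧
    ∃ L, jtStar ω (jt T ω).1 (jt T ω).2 = some (T, L) := by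
  have h1 : ω.1.1 = i := by rw [hω]
  have h2 : ω.1.2 = j := by rw [hω]
  obtain ⟨i1, i2, i3⟩ := forward_of_hole hω T ω (by rw [h1, h2]; exact .of_ordered_succ h)
    h1.ge h2.ge
  exact ⟨i1, by rw [h1, h2] at i2; exact i2, i3 T _ (jtStar_self ω T)⟩

/-- The equation of the two `jt` says that the forward move from `ω` first retraces the backward
path to `c`. It therefore survives each backward step once that step is undone by a forward step. -/
theorem backward_of_hole {i j : ℕ} {ω : Cell μ} (hω : ω.1 = (i, j)) (T : Filling μ) (c : Cell μ)
    (h : Hole i j T c.1.1 c.1.2) (ha : Act i j c.1.1 c.1.2) {T' : Filling μ} {L : List (ℕ × ℕ)}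
    (hs : jtStar ω T c = some (T', L)) :
    Ordered (i + 1) j T' ∧ jt T' ω = jt T c := by
  induction hn : c.1.1 + c.1.2 using Nat.strong_induction_on generalizing T c L with
  | _ n ih =>
  subst hn
  have h1 : ω.1.1 = i := by rw [hω]
  have h2 : ω.1.2 = j := by rw [hω]
  by_cases hc : c = ω
  · subst hc
    rw [jtStar_self] at hs
    simp only [Option.some.injEq, Prod.mk.injEq] at hs
    rw [h1, h2] at h
    exact ⟨hs.1 ▸ h.ordered_succ, by rw [hs.1]⟩
  cases hq : jtStarStep ω T c with
  | none =>
    rw [jtStar_of_none hc hq] at hs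
    exact absurd hs (by simp)
  | some p =>
  rw [jtStar_of_some hc hq] at hs
  simp only [Option.map_eq_some_iff, Prod.mk.injEq] at hs
  obtain ⟨⟨T'', L'⟩, hs, rfl, -⟩ := hs
  have hlt := jtStarStep_lt hq
  have hle := ((jtStar_iff ω p.1 p.2 L').1 ⟨_, hs⟩).le
  rw [jtStarStep_eq] at hq
  have hm : (c.1.1, c.1.2) ∈ μ := (YoungDiagram.mem_cells _).1 c.2
  rw [h1, h2] at hle
  split_ifs at hq with h3 h4
  · simp only [Option.some.injEq] at hq
    subst hq
    simp only at hs hlt hle ⊢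
    rw [h2] at h3
    set d := leftCell c with hd
    have hd1 : d.1.1 = c.1.1 := rfl
    have hd2 : c.1.2 = d.1.2 + 1 := by simp only [hd, leftCell]; omega
    have hcc : c.1 = (c.1.1, d.1.2 + 1) := by rw [← hd2]
    have had : Act i j d.1.1 d.1.2 := by unfold Act at *; omega
    have e1 : entry (slide T c d (T d - 1)) (d.1.1, d.1.2 + 1) = entry T (d.1.1, d.1.2) - 1 := by
      rw [entry_slide, if_neg (by grind), if_pos (by grind), ← entry_coe T d]
    have e2 : entry (slide T c d (T d - 1)) (d.1.1, d.1.2) = entry T (d.1.1, d.1.2 + 1) := by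
      rw [entry_slide, if_pos rfl, ← entry_coe T c, hcc, hd1]
    have e3 : ∀ a b, (a, b) ≠ (d.1.1, d.1.2) → (a, b) ≠ (d.1.1, d.1.2 + 1) →
        entry (slide T c d (T d - 1)) (a, b) = entry T (a, b) := by
      intro a b h1 h2
      rw [entry_slide, if_neg h1, if_neg (by grind)]
    have hhole : Hole i j T d.1.1 (d.1.2 + 1) := by rw [← hd2]; exact h
    have hu : ∀ a, d.1.1 = a + 1 → entry T (a, d.1.2 + 1) + 1 < entry T (d.1.1, d.1.2) := by
      intro a ha'
      have := h3.2
      grind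
    obtain ⟨i1, i2⟩ := ih _ hlt (slide T c d (T d - 1)) d
      (hhole.move_left had (by rw [← hd2]; exact hm) e1 e2 e3 hu) had hs rfl
    refine ⟨i1, i2.trans ?_⟩
    have hcd : c ≠ d := fun h => by rw [← h] at hd2; omega
    have hleft := hhole.left d.1.2 rfl had
    have hbelow := hhole.left_below d.1.2 rfl had
    -- The forward step from `d` must return to `c`: stopping contradicts `hleft`, and moving down
    -- contradicts strictness of the column of `d`.
    rcases jtStep_cases (slide T c d (T d - 1)) d with ⟨-, k1, k2⟩ | ⟨d', k1, k2, k3, k4⟩ |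
      ⟨d', k1, k2, k3, k4⟩
    · have := k1 (by rw [← hd2]; exact hm)
      rw [e1, e2] at this
      omega
    · obtain rfl : d' = c := Subtype.ext (by rw [k1, hd1, ← hd2])
      rw [jt_of_some k2, slide_slide T d' d]
      simp [slide, hcd]
    · have k5 := k4 (by rw [← hd2]; exact hm)
      have hmem : (d.1.1 + 1, d.1.2) ∈ μ := (YoungDiagram.mem_cells _).1 (k1 ▸ d'.2)
      rw [e1, e3 _ _ (by grind) (by grind)] at k5
      have := hhole.col d.1.1 d.1.2 had hmem (by grind) (by grind)
      omega
  · simp only [Option.some.injEq] at hq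
    subst hq
    simp only at hs hlt hle ⊢
    rw [h2] at h3
    set d := upCell c with hd
    have hd1 : d.1.2 = c.1.2 := rfl
    have hd2 : c.1.1 = d.1.1 + 1 := by simp only [hd, upCell]; omega
    have hcc : c.1 = (d.1.1 + 1, d.1.2) := by rw [← hd2]; rfl
    have had : Act i j d.1.1 d.1.2 := by unfold Act at *; omega
    have e1 : entry (slide T c d (T d + 1)) (d.1.1 + 1, d.1.2) = entry T (d.1.1, d.1.2) + 1 := by
      rw [entry_slide, if_neg (by grind), if_pos (by grind), ← entry_coe T d]
    have e2 : entry (slide T c d (T d + 1)) (d.1.1, d.1.2) = entry T (d.1.1 + 1, d.1.2) := by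
      rw [entry_slide, if_pos rfl, ← entry_coe T c, hcc]
    have e3 : ∀ a b, (a, b) ≠ (d.1.1, d.1.2) → (a, b) ≠ (d.1.1 + 1, d.1.2) →
        entry (slide T c d (T d + 1)) (a, b) = entry T (a, b) := by
      intro a b h1 h2
      rw [entry_slide, if_neg h1, if_neg (by grind)]
    have hhole : Hole i j T (d.1.1 + 1) d.1.2 := by rw [← hd2]; exact h
    have hl : ∀ b, d.1.2 = b + 1 → j ≤ b →
        entry T (d.1.1 + 1, b) ≤ entry T (d.1.1, d.1.2) + 1 := by
      intro b hb hjb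
      by_contra hlt'
      exact h3 ⟨by omega, Or.inr (by grind)⟩
    obtain ⟨i1, i2⟩ := ih _ hlt (slide T c d (T d + 1)) d
      (hhole.move_up had (by rw [← hd2]; exact hm) e1 e2 e3 hl) had hs rfl
    refine ⟨i1, i2.trans ?_⟩
    have hcd : c ≠ d := fun h => by rw [← h] at hd2; omega
    have hup := hhole.up d.1.1 rfl had
    have hmd : (d.1.1 + 1, d.1.2) ∈ μ := by rw [← hd2]; exact hm
    -- Again the step must return to `c`: stopping contradicts `hup`, and moving right contradicts
    -- the order of the row of `d`.
    rcases jtStep_cases (slide T c d (T d + 1)) d with ⟨-, k1, k2⟩ | ⟨d', k1, k2, k3, k4⟩ |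
      ⟨d', k1, k2, k3, k4⟩
    · have := k2 hmd
      rw [e1, e2] at this
      omega
    · have k5 := k4 hmd
      have hmem : (d.1.1, d.1.2 + 1) ∈ μ := (YoungDiagram.mem_cells _).1 (k1 ▸ d'.2)
      rw [e1, e3 _ _ (by grind) (by grind)] at k5
      have := hhole.row d.1.1 d.1.2 had hmem (by grind) (by grind)
      omega
    · obtain rfl : d' = c := Subtype.ext (by rw [k1, hcc])
      rw [jt_of_some k2, slide_slide T d' d]
      simp [slide, hcd]

/-- A backward path that reaches the distinguished cell is undone by forward jeu de taquin. -/
theorem backward_of_ordered {i j : ℕ} {ω : Cell μ} (hω : ω.1 = (i, j)) {T : Filling μ}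
    (h : Ordered i j T) (c : Cell μ) {T' : Filling μ} {L : List (ℕ × ℕ)}
    (hs : jtStar ω T c = some (T', L)) :
    Ordered (i + 1) j T' ∧ jt T' ω = (T, c) := by
  have hm : (c.1.1, c.1.2) ∈ μ := (YoungDiagram.mem_cells _).1 c.2
  have hle := ((jtStar_iff ω T c L).1 ⟨_, hs⟩).le
  rw [hω] at hle
  simp only at hle
  have ha : Act i j c.1.1 c.1.2 := by unfold Act; omega
  obtain ⟨h1, h2⟩ := backward_of_hole hω T c (.of_ordered h hm) ha hs
  refine ⟨h1, h2.trans (jt_of_none ?_)⟩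
  rcases jtStep_cases T c with ⟨k, -, -⟩ | ⟨d', k1, k2, k3, k4⟩ | ⟨d', k1, k2, k3, k4⟩
  · exact k
  · have := h.row _ _ ha ((YoungDiagram.mem_cells _).1 (k1 ▸ d'.2))
    omega
  · have := h.col _ _ ha ((YoungDiagram.mem_cells _).1 (k1 ▸ d'.2))
    omega

/-! ### Backward paths versus the sliding path. -/

/-- `T` is ordered after `(i, j)`, and `T'` arises from it by sorting the entry in `(i, j)`, which
ends up in `(i', j')`, into the tableau along the path coded by `top`. -/
structure SortsTo (i j : ℕ) (T T' : Filling μ) (i' j' : ℕ) (top : ℕ → ℕ) : Prop where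
  before : Ordered (i + 1) j T
  after : Ordered i j T'
  shift : Shift T T' i j i' j' top
  mem : (i', j') ∈ μ

/-- The backward path of a position stays below row `i'` until it reaches column `j'`. -/
inductive Far (i' j' j : ℕ) (T : Filling μ) : ℕ × ℕ → Prop
  | near {q : ℕ × ℕ} : q.2 ≤ j' → Far i' j' j T q
  | step {q : ℕ × ℕ} : j' < q.2 → i' < q.1 → Far i' j' j T (backStep j T q) → Far i' j' j T q

theorem Far.row_lt {i' j' j : ℕ} {T : Filling μ} {q : ℕ × ℕ} (h : Far i' j' j T q)
    (hq : j' < q.2) : i' < q.1 := by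
  cases h with
  | near h => omega
  | step _ h _ => exact h

theorem Far.backStep {i' j' j : ℕ} {T : Filling μ} {q : ℕ × ℕ} (h : Far i' j' j T q) :
    Far i' j' j T (backStep j T q) := by
  cases h with
  | near h =>
    refine .near ?_
    rcases backStep_cases j T q with ⟨h', _⟩ | h' <;> rw [h'] <;> simp only <;> omega
  | step _ _ h => exact h

namespace SortsTo

variable {i j i' j' : ℕ} {T T' : Filling μ} {top : ℕ → ℕ}

theorem le_top (h : SortsTo i j T T' i' j' top) (c : ℕ) : i ≤ top c := by
  rcases le_total c j with hc | hc
  · exact (h.shift.before c hc).ge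
  · exact (h.shift.before j le_rfl) ▸ h.shift.mono hc

theorem top_le (h : SortsTo i j T T' i' j' top) (c : ℕ) : top c ≤ i' := by
  have := h.shift.mono (show c ≤ max c (j' + 1) by omega)
  rwa [h.shift.after (max c (j' + 1)) (by omega)] at this

theorem row_le (h : SortsTo i j T T' i' j' top) : i ≤ i' := (h.le_top 0).trans (h.top_le 0)

theorem act (h : SortsTo i j T T' i' j' top) {r c : ℕ} (hc : j ≤ c) (hr : top c ≤ r) :
    Act i j r c := by
  have := h.le_top c
  unfold Act; omega

/-- To the right of column `j'` and below row `i'`, neither of the two entries compared lies on the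
sliding path. -/
theorem backStep_eq (h : SortsTo i j T T' i' j' top) {q : ℕ × ℕ} (h1 : j' < q.2) (h2 : i' < q.1) :
    backStep j T q = backStep j T' q := by
  have a := h.top_le (q.2 - 1 + 1)
  unfold backStep
  rw [h.shift.off (q.1 - 1) q.2 (by omega), h.shift.off q.1 (q.2 - 1) (by omega)]

theorem far_iff (h : SortsTo i j T T' i' j' top) (q : ℕ × ℕ) :
    Far i' j' j T q ↔ Far i' j' j T' q := by
  constructor <;> intro hq
  · induction hq with
    | near hq => exact .near hq
    | step h1 h2 _ ih => exact .step h1 h2 (h.backStep_eq h1 h2 ▸ ih)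
  · induction hq with
    | near hq => exact .near hq
    | step h1 h2 _ ih => exact .step h1 h2 (h.backStep_eq h1 h2 ▸ ih)

/-- The backward paths that reach `(i + 1, j)` before sorting pass below the path of the sorted
entry. -/
theorem top_lt_of_backPath (h : SortsTo i j T T' i' j' top) {q : ℕ × ℕ} {L : List (ℕ × ℕ)}
    (hq : BackPath j T (i + 1, j) q L) (hm : q ∈ μ) : top q.2 < q.1 ∧ Far i' j' j T q := by
  induction hq with
  | base => exact ⟨by simp [h.shift.before j le_rfl], .near h.shift.le⟩
  | @step q L _ h0 hL ih =>
    obtain ⟨r, c⟩ := q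
    have hle := hL.le
    have main : top c < r ∧ Far i' j' j T (backStep j T (r, c)) := by
      by_cases hs : j < c ∧ (r = 0 ∨ entry T (r - 1, c) + 1 < entry T (r, c - 1))
      · have e : backStep j T (r, c) = (r, c - 1) := if_pos hs
        rw [e] at ih hle ⊢
        obtain ⟨h1, h2⟩ := ih (mem_of_le hm le_rfl (by omega))
        refine ⟨?_, h2⟩
        obtain ⟨c, rfl⟩ : ∃ d, c = d + 1 := ⟨c - 1, by omega⟩
        simp only [Nat.add_sub_cancel] at h1 hs hle
        by_contra h3
        have hc : c ≤ j' := by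
          by_contra hc
          have := h.shift.after c (by omega)
          have := h.shift.after (c + 1) (by omega)
          omega
        obtain ⟨r, rfl⟩ : ∃ s, r = s + 1 := ⟨r - 1, by omega⟩
        simp only [Nat.add_sub_cancel] at hs
        -- If the path crossed here, the row order of `T'` would read `T (r + 1, c) - 1 ≤ T (r, c +
        -- 1)`, and the backward rule would have chosen up instead of left.
        have h4 := h.shift.down r c (by omega) hc (by omega) (by omega)
        have h5 := h.shift.off r (c + 1) (by omega)
        have h6 := h.after.row r c (h.act (by omega) (by omega)) (mem_of_le hm (by omega) le_rfl)
        omega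
      · have e : backStep j T (r, c) = (r - 1, c) := if_neg hs
        rw [e] at ih ⊢
        obtain ⟨h1, h2⟩ := ih (mem_of_le hm (by omega) le_rfl)
        simp only at h1
        exact ⟨by omega, h2⟩
    refine ⟨main.1, ?_⟩
    rcases le_or_gt c j' with hc | hc
    · exact .near hc
    · exact .step hc (by have := h.shift.after c hc; simp only; omega) main.2

/-- Converse of `top_lt_of_backPath`: a backward path that is below the sliding path never steps
onto it, so the only place where it can end is `(i + 1, j)`. -/
theorem backPath_of_top_lt (h : SortsTo i j T T' i' j' top) (q : ℕ × ℕ) (hm : q ∈ μ)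
    (hj : j ≤ q.2) (hr : top q.2 < q.1) (hf : Far i' j' j T q) :
    ∃ L, BackPath j T (i + 1, j) q L := by
  induction hn : q.1 + q.2 using Nat.strong_induction_on generalizing q with
  | _ n ih =>
  subst hn
  obtain ⟨r, c⟩ := q
  simp only at hj hr ih
  by_cases hq : (r, c) = (i + 1, j)
  · rw [hq]; exact ⟨_, .base⟩
  have hb := hf.backStep
  by_cases hs : j < c ∧ (r = 0 ∨ entry T (r - 1, c) + 1 < entry T (r, c - 1))
  · have e : backStep j T (r, c) = (r, c - 1) := if_pos hs
    have := h.shift.mono (show c - 1 ≤ c by omega)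
    obtain ⟨L, hL⟩ := ih (r + (c - 1)) (by omega) (r, c - 1) (mem_of_le hm le_rfl (by omega))
      (by simp only; omega) (by simp only; omega) (e ▸ hb) rfl
    exact ⟨_, .step hq (Or.inr hs.1) (e ▸ hL)⟩
  · have e : backStep j T (r, c) = (r - 1, c) := if_neg hs
    rw [e] at hb
    have key : top c < r - 1 := by
      by_contra h3
      by_cases hcj : c = j
      · subst hcj
        have := h.shift.before c le_rfl
        exact hq (Prod.ext (by simp only; omega) rfl)
      by_cases hc : c ≤ j'
      · obtain ⟨c, rfl⟩ : ∃ d, c = d + 1 := ⟨c - 1, by omega⟩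
        obtain ⟨r, rfl⟩ : ∃ s, r = s + 1 := ⟨r - 1, by omega⟩
        simp only [Nat.add_sub_cancel] at *
        -- The step up would enter the cell from which the sliding path took its entry to the left.
        -- Column strictness of `T'` then says that the backward rule chooses left, against `hs`.
        obtain rfl : r = top (c + 1) := by omega
        have h4 := h.shift.right c (by omega) (by omega)
        have h5 := h.shift.off (top (c + 1) + 1) c (by omega)
        have h6 := h.after.col (top (c + 1)) c
          (h.act (by omega) (h.shift.mono (by omega))) (mem_of_le hm le_rfl (by omega))
        exact hs ⟨by omega, Or.inr (by omega)⟩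
      · have := hb.row_lt (by simp only; omega)
        have := h.shift.after c (by omega)
        simp only at *
        omega
    obtain ⟨L, hL⟩ := ih (r - 1 + c) (by omega) (r - 1, c) (mem_of_le hm (by omega) le_rfl)
      hj key hb rfl
    exact ⟨_, .step hq (Or.inl (by simp only; omega)) (e ▸ hL)⟩

/-- The positions on the path of the sorted entry. -/
def OnPath (j j' : ℕ) (top : ℕ → ℕ) (d : ℕ × ℕ) : Prop :=
  j ≤ d.2 ∧ d.2 ≤ j' ∧ top d.2 ≤ d.1 ∧ d.1 ≤ top (d.2 + 1)

/-- Here and in `backStep_of_top_eq` it is the order of `T`, before sorting, that makes backward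
steps in `T'` retrace the sliding path. -/
theorem backStep_of_top_lt (h : SortsTo i j T T' i' j' top) {r c : ℕ}
    (hp : OnPath j j' top (r + 1, c)) (hr : top c ≤ r) (hm : (r + 1, c) ∈ μ) :
    backStep j T' (r + 1, c) = (r, c) := by
  obtain ⟨h1, h2, h3, h4⟩ := hp
  simp only at h1 h2 h3 h4
  refine if_neg fun hs => ?_
  simp only [Nat.add_sub_cancel] at hs
  obtain ⟨c, rfl⟩ : ∃ d, c = d + 1 := ⟨c - 1, by omega⟩
  simp only [Nat.add_sub_cancel] at hs
  have h5 := h.shift.down r (c + 1) h1 h2 hr (by omega)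
  have h6 := h.shift.off (r + 1) c (by omega)
  have := h.le_top c
  have h7 := h.before.row (r + 1) c (by have := h.le_top (c + 1); unfold Act; omega) hm
  omega

theorem backStep_of_top_eq (h : SortsTo i j T T' i' j' top) {c : ℕ} (hj : j ≤ c) (hc : c + 1 ≤ j')
    (hm : (top (c + 1), c + 1) ∈ μ) :
    backStep j T' (top (c + 1), c + 1) = (top (c + 1), c) := by
  refine if_pos ⟨by simp only; omega, ?_⟩
  simp only [Nat.add_sub_cancel]
  rcases Nat.eq_zero_or_eq_succ_pred (top (c + 1)) with h0 | h0
  · exact Or.inl h0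
  · right
    have h4 := h.shift.right c hj (by omega)
    have h5 := h.shift.off (top (c + 1) - 1) (c + 1) (by omega)
    have h6 := h.before.col (top (c + 1) - 1) (c + 1) (by unfold Act; omega) (by
      rwa [show top (c + 1) - 1 + 1 = top (c + 1) by omega])
    rw [show top (c + 1) - 1 + 1 = top (c + 1) by omega] at h6
    omega

theorem mem_of_onPath (h : SortsTo i j T T' i' j' top) {d : ℕ × ℕ} (hd : OnPath j j' top d) :
    d ∈ μ :=
  mem_of_le h.mem (hd.2.2.2.trans (h.top_le _)) hd.2.1

/-- From a position on the path of the sorted entry, the backward path follows that path. -/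
theorem exists_backPath_of_onPath (h : SortsTo i j T T' i' j' top) (d : ℕ × ℕ)
    (hd : OnPath j j' top d) : ∃ L, BackPath j T' (i, j) d L := by
  induction hn : d.1 + d.2 using Nat.strong_induction_on generalizing d with
  | _ n ih =>
  subst hn
  obtain ⟨r, c⟩ := d
  have hm := h.mem_of_onPath hd
  obtain ⟨h1, h2, h3, h4⟩ := id hd
  simp only at h1 h2 h3 h4 ih
  by_cases hq : (r, c) = (i, j)
  · rw [hq]; exact ⟨_, .base⟩
  rcases Nat.eq_or_lt_of_le h3 with h5 | h5
  · have hc : c ≠ j := by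
      rintro rfl
      rw [h.shift.before c le_rfl] at h5
      exact hq (by rw [h5])
    obtain ⟨c, rfl⟩ : ∃ d, c = d + 1 := ⟨c - 1, by omega⟩
    subst h5
    obtain ⟨L, hL⟩ := ih _ (by omega) (top (c + 1), c)
      ⟨by simp only; omega, by simp only; omega, h.shift.mono (by omega), le_rfl⟩ rfl
    exact ⟨_, .step hq (Or.inr (by simp only; omega))
      ((h.backStep_of_top_eq (by omega) h2 hm).symm ▸ hL)⟩
  · obtain ⟨r, rfl⟩ : ∃ s, r = s + 1 := ⟨r - 1, by omega⟩
    obtain ⟨L, hL⟩ := ih _ (by omega) (r, c) ⟨h1, h2, by simp only; omega, by simp only; omega⟩ rfl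
    exact ⟨_, .step hq (Or.inl (by simp)) ((h.backStep_of_top_lt hd (by omega) hm).symm ▸ hL)⟩

theorem onPath_last (h : SortsTo i j T T' i' j' top) : OnPath j j' top (i', j') :=
  ⟨h.shift.le, le_rfl, h.top_le j', (h.shift.after (j' + 1) (by omega)).ge⟩

/-- The part of the path of the sorted entry after a given position. -/
theorem backPath_split (h : SortsTo i j T T' i' j' top) {P : List (ℕ × ℕ)}
    (hP : BackPath j T' (i, j) (i', j') P) (d : ℕ × ℕ) (hd : OnPath j j' top d) :
    ∃ L R, BackPath j T' (i, j) d L ∧ P = L ++ R ∧ (d = (i', j') → R = []) ∧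
      (d.1 < top (d.2 + 1) → ∃ R', R = (d.1 + 1, d.2) :: R') ∧
      (d.1 = top (d.2 + 1) → d.2 < j' → ∃ R', R = (d.1, d.2 + 1) :: R') := by
  induction hn : i' + j' - (d.1 + d.2) using Nat.strong_induction_on generalizing d with
  | _ n ih =>
  subst hn
  obtain ⟨r, c⟩ := d
  have hm := h.mem_of_onPath hd
  obtain ⟨h1, h2, h3, h4⟩ := id hd
  simp only at h1 h2 h3 h4 ih
  have h5 := h.top_le (c + 1)
  have h6 := h.le_top c
  rcases Nat.eq_or_lt_of_le h4 with h7 | h7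
  · subst h7
    rcases Nat.eq_or_lt_of_le h2 with h8 | h8
    · subst h8
      have h9 := h.shift.after (c + 1) (by omega)
      refine ⟨P, [], ?_, by simp, fun _ => rfl, fun h => ?_, fun _ h => ?_⟩
      · rw [h9]; exact hP
      · simp only at h; omega
      · simp only at h; omega
    · have hd' : OnPath j j' top (top (c + 1), c + 1) :=
        ⟨by simp only; omega, h8, le_rfl, h.shift.mono (by omega)⟩
      obtain ⟨L', R', i1, i2, -⟩ := ih _ (by simp only; omega) _ hd' rfl
      rw [i2]
      generalize hq : (top (c + 1), c + 1) = q at i1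
      cases i1 with
      | base => grind
      | @step _ L _ _ hL =>
        subst hq
        rw [h.backStep_of_top_eq h1 h8 (h.mem_of_onPath hd')] at hL
        exact ⟨L, (top (c + 1), c + 1) :: R', hL, by simp, fun h => by grind,
          fun h => by simp only at h; omega, fun _ _ => ⟨R', rfl⟩⟩
  · have hd' : OnPath j j' top (r + 1, c) := ⟨h1, h2, by simp only; omega, h7⟩
    obtain ⟨L', R', i1, i2, -⟩ := ih _ (by simp only; omega) _ hd' rfl
    rw [i2]
    generalize hq : (r + 1, c) = q at i1
    cases i1 with
    | base => grind
    | @step _ L _ _ hL =>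
      subst hq
      rw [h.backStep_of_top_lt hd' h3 (h.mem_of_onPath hd')] at hL
      exact ⟨L, (r + 1, c) :: R', hL, by simp, fun h => by grind,
        fun _ => ⟨R', rfl⟩, fun h => by simp only at h; omega⟩

end SortsTo

/-! ### Comparing backward paths with the sliding path. -/

theorem comesBefore_append (X : List (ℕ × ℕ)) (d : ℕ × ℕ) (P Q : List (ℕ × ℕ)) :
    comesBefore (X ++ d :: P) (X ++ d :: Q) = comesBefore (d :: P) (d :: Q) := by
  induction X with
  | nil => rfl
  | cons x X ih =>
    cases X with
    | nil => simp [comesBefore]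
    | cons y X =>
      simp only [List.cons_append] at ih ⊢
      rw [comesBefore, if_pos rfl, ih]

theorem comesBefore_append_nil (X : List (ℕ × ℕ)) (d : ℕ × ℕ) (P : List (ℕ × ℕ)) :
    comesBefore (X ++ d :: P) (X ++ [d]) = comesBefore (d :: P) [d] :=
  comesBefore_append X d P []

namespace SortsTo

variable {i j i' j' : ℕ} {T T' : Filling μ} {top : ℕ → ℕ}

/-- After sorting, the backward paths from below the path of the sorted entry reach `(i, j)`, and
they join that path from below. -/
theorem exists_backPath_of_top_lt (h : SortsTo i j T T' i' j' top) (q : ℕ × ℕ)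
    (hj : j ≤ q.2) (hr : top (q.2 + 1) < q.1) (hf : Far i' j' j T' q) :
    ∃ d M R, OnPath j j' top d ∧ d.1 = top (d.2 + 1) ∧ BackPath j T' (i, j) d (M ++ [d]) ∧
      BackPath j T' (i, j) q (M ++ d :: (d.1 + 1, d.2) :: R) := by
  induction hn : q.1 + q.2 using Nat.strong_induction_on generalizing q with
  | _ n ih =>
  subst hn
  obtain ⟨r, c⟩ := q
  simp only at hj hr ih
  have hl := h.le_top (c + 1)
  have hq : (r, c) ≠ (i, j) := by
    intro h
    have := (Prod.mk.inj h).1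
    omega
  have hb := hf.backStep
  by_cases hs : j < c ∧ (r = 0 ∨ entry T' (r - 1, c) + 1 < entry T' (r, c - 1))
  · have e : backStep j T' (r, c) = (r, c - 1) := if_pos hs
    have := h.shift.mono (show c - 1 + 1 ≤ c + 1 by omega)
    obtain ⟨d, M, R, i1, i2, i3, i4⟩ := ih (r + (c - 1)) (by omega) (r, c - 1)
      (by simp only; omega) (by simp only; omega) (e ▸ hb) rfl
    rw [← e] at i4
    refine ⟨d, M, R ++ [(r, c)], i1, i2, i3, ?_⟩
    have := BackPath.step hq (Or.inr hs.1) i4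
    rwa [List.append_assoc] at this
  · have e : backStep j T' (r, c) = (r - 1, c) := if_neg hs
    rcases Nat.eq_or_lt_of_le (show top (c + 1) ≤ r - 1 by omega) with h1 | h1
    · have hc : c ≤ j' := by
        by_contra hc
        have := (e ▸ hb).row_lt (by simp only; omega)
        have := h.shift.after (c + 1) (by omega)
        simp only at *
        omega
      -- The step lands on the lowest cell of the sliding path in column `c`; from there on both
      -- backward paths coincide.
      have hd : OnPath j j' top (r - 1, c) :=
        ⟨hj, hc, by simp only; rw [← h1]; exact h.shift.mono (by omega), h1.ge⟩
      obtain ⟨L, hL⟩ := h.exists_backPath_of_onPath _ hd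
      obtain ⟨M, rfl⟩ := hL.exists_concat
      refine ⟨_, M, [], hd, h1.symm, hL, ?_⟩
      have := BackPath.step hq (Or.inl (by simp only; omega)) (e.symm ▸ hL)
      rw [List.append_assoc, e] at this
      simpa [show r - 1 + 1 = r by omega] using this
    · obtain ⟨d, M, R, i1, i2, i3, i4⟩ := ih (r - 1 + c) (by omega) (r - 1, c)
        hj h1 (e ▸ hb) rfl
      rw [← e] at i4
      refine ⟨d, M, R ++ [(r, c)], i1, i2, i3, ?_⟩
      have := BackPath.step hq (Or.inl (by simp only; omega)) i4
      rwa [List.append_assoc] at this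

/-- After sorting, the path of the sorted entry comes before the backward paths from weakly below
that path. -/
theorem comesBefore_of_top_le (h : SortsTo i j T T' i' j' top) {P : List (ℕ × ℕ)}
    (hP : BackPath j T' (i, j) (i', j') P) (q : ℕ × ℕ)
    (hj : j ≤ q.2) (hr : top (q.2 + 1) ≤ q.1) (hf : Far i' j' j T' q) (hq : q ≠ (i', j')) :
    ∃ L, BackPath j T' (i, j) q L ∧ comesBefore P L = true := by
  rcases Nat.eq_or_lt_of_le hr with h1 | h1
  · have hc : q.2 ≤ j' := by
      by_contra hc
      have := hf.row_lt (by omega)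
      have := h.shift.after (q.2 + 1) (by omega)
      omega
    -- The position is the lowest path cell of its column, so its backward path is an initial piece
    -- of `P`, which continues to the right.
    have hd : OnPath j j' top q := ⟨hj, hc, h1 ▸ h.shift.mono (by omega), h1.ge⟩
    obtain ⟨L, R, i1, i2, -, -, i5⟩ := h.backPath_split hP q hd
    obtain ⟨R', rfl⟩ := i5 h1.symm (by
      refine lt_of_le_of_ne hc fun h2 => hq (Prod.ext ?_ h2)
      rw [← h1, h.shift.after _ (by omega)])
    obtain ⟨M, rfl⟩ := i1.exists_concat
    refine ⟨_, i1, ?_⟩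
    rw [i2, List.append_assoc]
    simp [comesBefore_append_nil, comesBefore]
  · obtain ⟨d, M, R, hd, hdt, hdL, hqL⟩ := h.exists_backPath_of_top_lt q hj h1 hf
    refine ⟨_, hqL, ?_⟩
    obtain ⟨L, R', i1, i2, i3, -, i5⟩ := h.backPath_split hP d hd
    rw [i1.unique hdL] at i2
    rw [i2, List.append_assoc, List.singleton_append, comesBefore_append]
    -- At `d` the path of `q` goes down, whereas `P` ends or turns right.
    rcases Nat.eq_or_lt_of_le hd.2.1 with h2 | h2
    · rw [i3 (Prod.ext (by rw [hdt, h.shift.after _ (by omega)]) h2)]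
      simp [comesBefore]
    · obtain ⟨R'', rfl⟩ := i5 hdt h2
      simp [comesBefore]

/-- Induction outwards from `(i, j)`. A path outside the region weakly below `P` is either a piece
of `P` that `P` continues downwards, or it turns right at a cell where `P` ends or goes down. In
neither case does it come after `P`. -/
theorem region_of_backPath (h : SortsTo i j T T' i' j' top) {P : List (ℕ × ℕ)}
    (hP : BackPath j T' (i, j) (i', j') P) {q : ℕ × ℕ} {L : List (ℕ × ℕ)}
    (hq : BackPath j T' (i, j) q L) :
    (top (q.2 + 1) ≤ q.1 ∧ Far i' j' j T' q) ∨ (OnPath j j' top q ∧ q.1 < top (q.2 + 1)) ∨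
    ∃ d M R, OnPath j j' top d ∧ BackPath j T' (i, j) d (M ++ [d]) ∧
      (d = (i', j') ∨ d.1 < top (d.2 + 1)) ∧ L = M ++ d :: (d.1, d.2 + 1) :: R := by
  induction hq with
  | base =>
    have h1 := h.shift.before j le_rfl
    rcases le_or_gt (top (j + 1)) i with h2 | h2
    · exact Or.inl ⟨h2, .near h.shift.le⟩
    · exact Or.inr (Or.inl ⟨⟨le_rfl, h.shift.le, h1.le, h2.le⟩, h2⟩)
  | @step q L hqω h0 hL ih =>
    obtain ⟨r, c⟩ := q
    simp only at h0
    have hle := hL.le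
    rcases ih with ⟨i1, i2⟩ | ⟨i1, i2⟩ | ⟨d, M, R, i1, i2, i3, rfl⟩
    · rcases backStep_cases j T' (r, c) with ⟨e, hjc⟩ | e
      · simp only at e hjc
        rw [e] at i1 hle
        simp only at i1 hle
        rw [show c - 1 + 1 = c by omega] at i1
        by_cases hend : (r, c - 1) = (i', j')
        · obtain ⟨M, rfl⟩ := hL.exists_concat
          refine Or.inr (Or.inr ⟨(i', j'), M, [], h.onPath_last, ?_, Or.inl rfl, ?_⟩)
          · rw [e, hend] at hL; exact hL
          · rw [e, hend]
            have h1 := (Prod.mk.inj hend).1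
            have h2 := (Prod.mk.inj hend).2
            have h3 : c = j' + 1 := by omega
            subst h1 h3
            simp
        have hfar : Far i' j' j T' (r, c) := by
          rcases le_or_gt c j' with hc | hc
          · exact .near hc
          · refine .step hc ?_ i2
            have h1 := h.shift.after c hc
            rcases Nat.eq_or_lt_of_le (show j' ≤ c - 1 by omega) with h2 | h2
            · simp only
              refine lt_of_le_of_ne (by omega) fun h3 => hend (by rw [h3, h2])
            · have := i2.row_lt (by rw [e]; exact h2)
              rw [e] at this
              exact this
        rcases le_or_gt (top (c + 1)) r with h2 | h2
        · exact Or.inl ⟨h2, hfar⟩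
        · refine Or.inr (Or.inl ⟨⟨hjc.le, ?_, i1, h2.le⟩, h2⟩)
          by_contra hc
          have := h.shift.after c (by simp only at hc; omega)
          have := h.shift.after (c + 1) (by simp only at hc; omega)
          omega
      · simp only at e
        rw [e] at i1 hle
        simp only at i1 hle
        refine Or.inl ⟨by simp only; omega, ?_⟩
        rcases le_or_gt c j' with hc | hc
        · exact .near hc
        · refine .step hc ?_ i2
          have := i2.row_lt (by rw [e]; exact hc)
          rw [e] at this
          simp only at this ⊢
          omega
    · rcases backStep_cases j T' (r, c) with ⟨e, hjc⟩ | e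
      · simp only at e hjc
        obtain ⟨M, rfl⟩ := hL.exists_concat
        refine Or.inr (Or.inr ⟨_, M, [], i1, hL, Or.inr i2, ?_⟩)
        rw [e]
        simp [show c - 1 + 1 = c by omega]
      · simp only at e
        rw [e] at i1 i2 hle
        obtain ⟨k1, k2, k3, k4⟩ := i1
        simp only at k1 k2 k3 k4 i2 hle
        -- With `r = 0` the truncated subtraction would make the step stay in place, and no backward
        -- path could reach `(i, j)` from there.
        have hr : r ≠ 0 := by
          rintro rfl
          have : ∀ q L, BackPath j T' (i, j) q L → q = (0, c) → q = (i, j) := by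
            intro q L hq
            induction hq with
            | base => exact fun _ => rfl
            | @step q L g0 g1 g2 ig =>
              rintro rfl
              rw [e] at ig
              exact ig rfl
          rw [e] at hL
          exact hqω (this _ _ hL rfl)
        rcases Nat.eq_or_lt_of_le (show r ≤ top (c + 1) by omega) with h2 | h2
        · exact Or.inl ⟨h2.ge, .near k2⟩
        · exact Or.inr (Or.inl ⟨⟨k1, k2, by simp only; omega, h2.le⟩, h2⟩)
    · exact Or.inr (Or.inr ⟨d, M, R ++ [(r, c)], i1, i2, i3, by simp⟩)

/-- After sorting, the backward paths that come after the path of the sorted entry start weakly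
below that path. -/
theorem top_le_of_comesBefore (h : SortsTo i j T T' i' j' top) {P : List (ℕ × ℕ)}
    (hP : BackPath j T' (i, j) (i', j') P) {q : ℕ × ℕ} {L : List (ℕ × ℕ)}
    (hq : BackPath j T' (i, j) q L) (hb : comesBefore P L = true) :
    top (q.2 + 1) ≤ q.1 ∧ Far i' j' j T' q := by
  rcases h.region_of_backPath hP hq with h1 | ⟨h1, h2⟩ | ⟨d, M, R, h1, h2, h3, rfl⟩
  · exact h1
  · obtain ⟨L', R, i1, i2, -, i4, -⟩ := h.backPath_split hP q h1
    obtain ⟨R', rfl⟩ := i4 h2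
    rw [← hq.unique i1] at i2
    obtain ⟨M, rfl⟩ := hq.exists_concat
    rw [i2, List.append_assoc, List.singleton_append, comesBefore_append_nil] at hb
    simp [comesBefore] at hb
  · obtain ⟨L', R', i1, i2, i3, i4, -⟩ := h.backPath_split hP d h1
    rw [i1.unique h2] at i2
    rw [i2, List.append_assoc, List.singleton_append, comesBefore_append] at hb
    rcases h3 with h3 | h3
    · rw [i3 h3] at hb
      simp [comesBefore] at hb
    · obtain ⟨R'', rfl⟩ := i4 h3
      simp [comesBefore] at hb

end SortsTo

/-! ### The order of backward paths to a common cell is total. -/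

theorem comesBefore_cons_cons (c c' d d' : ℕ × ℕ) (P Q : List (ℕ × ℕ)) :
    comesBefore (c :: c' :: P) (d :: d' :: Q) =
      if c' = d' then comesBefore (c' :: P) (d' :: Q)
      else decide (c' = (c.1, c.2 + 1) ∧ d' = (d.1 + 1, d.2)) := by
  rw [comesBefore]

theorem comesBefore_asymm : ∀ P Q : List (ℕ × ℕ), comesBefore P Q = true → comesBefore Q P ≠ true
  | [], _ => by simp [comesBefore]
  | [_], [] => by simp [comesBefore]
  | [_], [_] => by simp [comesBefore]
  | [_], _ :: _ :: _ => by simp [comesBefore]; grind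
  | _ :: _ :: _, [] => by simp [comesBefore]
  | _ :: _ :: _, [_] => by simp [comesBefore]; grind
  | c :: c' :: P, d :: d' :: Q => by
    rw [comesBefore_cons_cons c, comesBefore_cons_cons d]
    by_cases h : c' = d'
    · subst h
      rw [if_pos rfl, if_pos rfl]
      exact comesBefore_asymm _ _
    · rw [if_neg h, if_neg (Ne.symm h)]
      grind

theorem comesBefore_trans (P Q R : List (ℕ × ℕ)) (x : ℕ × ℕ)
    (h1 : comesBefore (x :: P) (x :: Q) = true) (h2 : comesBefore (x :: Q) (x :: R) = true) :
    comesBefore (x :: P) (x :: R) = true := by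
  induction P generalizing x Q R with
  | nil =>
    cases Q <;> cases R <;> simp [comesBefore] at h1 h2 ⊢
    · grind
    · split_ifs at h2 <;> grind
  | cons p P ih =>
    cases Q with
    | nil =>
      cases R <;> simp [comesBefore] at h1 h2 ⊢
      grind
    | cons q Q =>
      cases R with
      | nil =>
        simp only [comesBefore] at h1 h2 ⊢
        split_ifs at h1 <;> grind
      | cons r R =>
        simp only [comesBefore] at h1 h2 ⊢
        split_ifs at h1 h2 ⊢ <;> grind

/-- A list of positions in which each one is the right or lower neighbour of the previous one. -/
def IsLatticePath (L : List (ℕ × ℕ)) : Prop :=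
  L.IsChain fun a b => b = (a.1, a.2 + 1) ∨ b = (a.1 + 1, a.2)

theorem comesBefore_total (P Q : List (ℕ × ℕ)) (x : ℕ × ℕ) (hP : IsLatticePath (x :: P))
    (hQ : IsLatticePath (x :: Q)) (h : P ≠ Q) :
    comesBefore (x :: P) (x :: Q) = true ∨ comesBefore (x :: Q) (x :: P) = true := by
  induction P generalizing x Q with
  | nil =>
    cases Q with
    | nil => exact absurd rfl h
    | cons q Q =>
      have := (List.isChain_cons_cons.1 hQ).1
      simp [comesBefore]
      grind
  | cons p P ih =>
    obtain ⟨h1, h2⟩ := List.isChain_cons_cons.1 hP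
    cases Q with
    | nil =>
      simp [comesBefore]
      grind
    | cons q Q =>
      obtain ⟨h3, h4⟩ := List.isChain_cons_cons.1 hQ
      by_cases hpq : p = q
      · subst hpq
        have := ih Q p h2 h4 (by grind)
        simpa [comesBefore] using this
      · simp [comesBefore, hpq, Ne.symm hpq]
        grind

theorem BackPath.isLatticePath {j : ℕ} {T : Filling μ} {ω p : ℕ × ℕ} {L : List (ℕ × ℕ)}
    (h : BackPath j T ω p L) : IsLatticePath L := by
  induction h with
  | base => exact List.isChain_singleton _
  | @step p L _ h0 hL ih =>
    obtain ⟨M, rfl⟩ := hL.exists_concat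
    refine List.isChain_append.2 ⟨ih, List.isChain_singleton _, ?_⟩
    intro a ha b hb
    simp only [List.getLast?_append, List.getLast?_singleton, Option.some_or, Option.mem_def,
      Option.some.injEq, List.head?_cons] at ha hb
    subst ha hb
    unfold backStep
    split_ifs with hs
    · left
      ext
      · rfl
      · simp only; omega
    · right
      have : p.1 ≠ 0 := fun h => hs ⟨by grind, Or.inl h⟩
      ext
      · simp only; omega
      · rfl

theorem BackPath.exists_cons {j : ℕ} {T : Filling μ} {ω p : ℕ × ℕ} {L : List (ℕ × ℕ)}
    (h : BackPath j T ω p L) : ∃ M, L = ω :: M := by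
  induction h with
  | base => exact ⟨[], rfl⟩
  | step _ _ _ ih =>
    obtain ⟨M, rfl⟩ := ih
    exact ⟨_, rfl⟩

/-- Different candidates have different paths, as the list of a path ends in its candidate; so
totality and transitivity provide a minimum. -/
theorem exists_first_backPath {j : ℕ} {T : Filling μ} {ω : ℕ × ℕ} (l : List (ℕ × ℕ))
    (hl : l ≠ []) (h : ∀ p ∈ l, ∃ L, BackPath j T ω p L) :
    ∃ e ∈ l, ∃ P, BackPath j T ω e P ∧
      ∀ p ∈ l, p ≠ e → ∀ L, BackPath j T ω p L → comesBefore P L = true := by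
  induction l with
  | nil => exact absurd rfl hl
  | cons a l ih =>
    obtain ⟨A, hA⟩ := h a (by simp)
    by_cases hl' : l = []
    · subst hl'
      exact ⟨a, by simp, A, hA, fun p hp hpa => by simp at hp; exact absurd hp hpa⟩
    obtain ⟨e, he, P, hP, hmin⟩ := ih hl' fun p hp => h p (by simp [hp])
    obtain ⟨A', rfl⟩ := hA.exists_cons
    obtain ⟨P', rfl⟩ := hP.exists_cons
    by_cases hae : a = e
    · subst hae
      refine ⟨a, by simp, _, hP, fun p hp hpa L hL => ?_⟩
      exact hmin p (by simp [hpa] at hp; exact hp) hpa L hL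
    have hne : A' ≠ P' := by
      rintro rfl
      obtain ⟨M, h1⟩ := hA.exists_concat
      obtain ⟨M', h2⟩ := hP.exists_concat
      rw [h1] at h2
      exact hae (List.singleton_injective (List.append_inj' h2 rfl).2)
    rcases comesBefore_total A' P' ω hA.isLatticePath hP.isLatticePath hne with hc | hc
    · refine ⟨a, by simp, _, hA, fun p hp hpa L hL => ?_⟩
      have hp : p ∈ l := by simpa [hpa] using hp
      by_cases hpe : p = e
      · subst hpe
        rwa [hL.unique hP]
      · obtain ⟨L', rfl⟩ := hL.exists_cons
        exact comesBefore_trans _ _ _ _ hc (hmin p hp hpe _ hL)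
    · refine ⟨e, by simp [he], _, hP, fun p hp hpe L hL => ?_⟩
      rcases List.mem_cons.1 hp with rfl | hp
      · rwa [hL.unique hA]
      · exact hmin p hp hpe L hL

/-! ### Evaluating one loop of the inverse algorithm. -/

theorem mapM_eq_some_map {α β : Type*} (f : α → Option β) (g : α → β) (l : List α)
    (h : ∀ x ∈ l, f x = some (g x)) : l.mapM f = some (l.map g) := by
  induction l with
  | nil => rfl
  | cons a l ih =>
    rw [List.mapM_cons, h a (by simp), ih fun x hx => h x (by simp [hx])]
    rfl

/-- Whatever `find?` returns comes before all other candidates, hence is `e` by asymmetry of the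
order. -/
theorem loopHCStar_eq {T H : Filling μ} {ω : Cell μ} {e : ℕ × ℕ} {T₀ : Filling μ}
    {P : List (ℕ × ℕ)} (he : e ∈ candidates ω H) (hb : backwardMove ω T e = some (e, T₀, P))
    (hall : ∀ p ∈ candidates ω H, p ≠ e →
      ∃ T' L, backwardMove ω T p = some (p, T', L) ∧ comesBefore P L = true) :
    loopHCStar (T, H) ω = some (T₀, shiftDown ω e.1 H) := by
  have hex : ∀ p, ∃ m : (ℕ × ℕ) × Filling μ × List (ℕ × ℕ), p ∈ candidates ω H →
      backwardMove ω T p = some m ∧ m.1 = p ∧ (p ≠ e → comesBefore P m.2.2 = true) := by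
    intro p
    by_cases hp : p ∈ candidates ω H
    · by_cases hpe : p = e
      · subst hpe
        exact ⟨(p, T₀, P), fun _ => ⟨hb, rfl, fun h => absurd rfl h⟩⟩
      · obtain ⟨T', L, h1, h2⟩ := hall p hp hpe
        exact ⟨(p, T', L), fun _ => ⟨h1, rfl, fun _ => h2⟩⟩
    · exact ⟨(p, T₀, P), fun h => absurd h hp⟩
  choose g hg using hex
  have hge : g e = (e, T₀, P) := Option.some.inj ((hg e he).1.symm.trans hb)
  unfold loopHCStar
  simp only
  rw [mapM_eq_some_map _ g _ fun p hp => (hg p hp).1, Option.bind_some]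
  set pred : (ℕ × ℕ) × Filling μ × List (ℕ × ℕ) → Bool := fun m =>
    ((candidates ω H).map g).all fun m' =>
      decide (m'.1 = m.1) || comesBefore m.2.2 m'.2.2 with hpred
  have hpe : pred (g e) = true := by
    simp only [hpred, List.all_eq_true, List.mem_map]
    rintro m' ⟨p, hp, rfl⟩
    rw [hge, (hg p hp).2.1]
    by_cases hpe : p = e
    · simp [hpe]
    · simp [(hg p hp).2.2 hpe]
  cases hf : ((candidates ω H).map g).find? pred with
  | none =>
    rw [List.find?_eq_none] at hf
    exact absurd hpe (hf _ (List.mem_map_of_mem he))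
  | some m =>
    have h1 := List.find?_some hf
    obtain ⟨p, hp, rfl⟩ := List.mem_map.1 (List.mem_of_find?_eq_some hf)
    simp only [hpred, List.all_eq_true] at h1
    have h2 := h1 _ (List.mem_map_of_mem he)
    by_cases hpe : p = e
    · rw [hpe, hge]; rfl
    · rw [hge, (hg p hp).2.1] at h2
      simp only [Bool.or_eq_true, decide_eq_true_eq, Ne.symm hpe, false_or] at h2
      exact absurd ((hg p hp).2.2 hpe) (comesBefore_asymm _ _ h2)

theorem mem_candidates {ω : Cell μ} {H : Filling μ} {p : ℕ × ℕ} :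
    p ∈ candidates ω H ↔ ∃ k, (k, ω.1.2) ∈ μ ∧ ω.1.1 ≤ k ∧ entry H (k, ω.1.2) ≤ 0 ∧
      p = (k, ω.1.2 + (-entry H (k, ω.1.2)).toNat) := by
  simp only [candidates, List.mem_map, List.mem_filter, List.mem_range, decide_eq_true_eq,
    YoungDiagram.mem_iff_lt_colLen]
  constructor
  · rintro ⟨k, ⟨h1, h2, h3⟩, rfl⟩
    exact ⟨k, h1, h2, h3, rfl⟩
  · rintro ⟨k, h1, h2, h3, rfl⟩
    exact ⟨k, ⟨h1, h2, h3⟩, rfl⟩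

theorem backwardMove_eq {ω : Cell μ} {T T' : Filling μ} {c : Cell μ} {L : List (ℕ × ℕ)}
    (h : jtStar ω T c = some (T', L)) : backwardMove ω T c.1 = some (c.1, T', L) := by
  rw [backwardMove, dif_pos c.2, h]
  rfl

theorem entry_shiftUp (ω ω' : Cell μ) (H : Filling μ) {r c : ℕ} (hm : (r, c) ∈ μ) :
    entry (shiftUp ω ω' H) (r, c) =
      if c = ω.1.2 ∧ ω.1.1 ≤ r ∧ r < ω'.1.1 then entry H (r + 1, c) + 1
      else if (r, c) = (ω'.1.1, ω.1.2) then (ω.1.2 : ℤ) - (ω'.1.2 : ℤ)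
      else entry H (r, c) := by
  have hm' := (YoungDiagram.mem_cells _).2 hm
  rw [entry_mk _ _ hm', entry_mk H _ hm']
  rfl

theorem entry_shiftDown (ω : Cell μ) (i' : ℕ) (H : Filling μ) {r c : ℕ} (hm : (r, c) ∈ μ) :
    entry (shiftDown ω i' H) (r, c) =
      if c = ω.1.2 ∧ ω.1.1 < r ∧ r ≤ i' then entry H (r - 1, c) - 1
      else if (r, c) = ω.1 then 0
      else entry H (r, c) := by
  have hm' := (YoungDiagram.mem_cells _).2 hm
  rw [entry_mk _ _ hm', entry_mk H _ hm']
  simp only [shiftDown, Subtype.ext_iff]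

/-! ### The invariants and their ranges of entries. -/

/-- The entries are those of a content tabloid. -/
def InContentRange (b : ℕ) (T : Filling μ) : Prop :=
  ∀ r c, (r, c) ∈ μ → 1 - ((c : ℤ) - r) ≤ entry T (r, c) ∧ entry T (r, c) ≤ b

/-- The entries are those of a hook tabloid. -/
def InHookRange (H : Filling μ) : Prop :=
  ∀ r c, (r, c) ∈ μ → -((μ.rowLen r : ℤ) - c - 1) ≤ entry H (r, c) ∧
    entry H (r, c) ≤ (μ.colLen c : ℤ) - r - 1

/-- The pairs that occur in both algorithms between the loops for `(i, j)` and its predecessor. -/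
structure IsState (b i j : ℕ) (p : Filling μ × Filling μ) : Prop where
  range : InContentRange b p.1
  ordered : Ordered i j p.1
  hook : InHookRange p.2
  zero : ∀ r c, ¬ Act i j r c → entry p.2 (r, c) = 0
  reach : ∀ k, i ≤ k → (k, j) ∈ μ → entry p.2 (k, j) ≤ 0 →
    ∃ L, BackPath j p.1 (i, j) (k, j + (-entry p.2 (k, j)).toNat) L

theorem InHookRange.mem {H : Filling μ} (h : InHookRange H) {k j : ℕ} (hk : (k, j) ∈ μ) :
    (k, j + (-entry H (k, j)).toNat) ∈ μ := by
  have h1 := (h k j hk).1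
  rw [YoungDiagram.mem_iff_lt_rowLen] at hk ⊢
  omega

namespace SortsTo

variable {i j i' j' : ℕ} {T T' : Filling μ} {top : ℕ → ℕ}

/-- The change by one of a displaced entry equals the change of the bound `1 - c_ρ` between its two
cells. From above, entries on the path are bounded by the last one, which is the old entry of `(i,
j)`. -/
theorem range_after (h : SortsTo i j T T' i' j' top) {b : ℕ} (hT : InContentRange b T)
    (hω : (i, j) ∈ μ) : InContentRange b T' := by
  intro r c hm
  by_cases hp : OnPath j j' top (r, c)
  · obtain ⟨h1, h2, h3, h4⟩ := id hp
    simp only at h1 h2 h3 h4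
    have hr := h4.trans (h.top_le _)
    refine ⟨?_, ?_⟩
    · have main : ∀ r c, OnPath j j' top (r, c) → (r, c) ≠ (i', j') →
          1 - ((c : ℤ) - r) ≤ entry T' (r, c) := by
        rintro r c hp hne
        obtain ⟨h1, h2, h3, h4⟩ := id hp
        simp only at h1 h2 h3 h4
        have hr := h4.trans (h.top_le _)
        rcases Nat.eq_or_lt_of_le h4 with h5 | h5
        · have h6 : c < j' := by
            refine lt_of_le_of_ne h2 fun h6 => hne ?_
            rw [h5, h6, h.shift.after _ (by omega)]
          have h7 := h.shift.right c h1 h6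
          rw [← h5] at h7
          have h8 := (hT r (c + 1) (mem_of_le h.mem hr h6)).1
          push_cast at h8
          omega
        · have h7 := h.shift.down r c h1 h2 h3 h5
          have := h.top_le (c + 1)
          have h8 := (hT (r + 1) c (mem_of_le h.mem (by omega) h2)).1
          push_cast at h8
          omega
      by_cases hne : (r, c) = (i', j')
      · obtain ⟨rfl, rfl⟩ := Prod.mk.inj hne
        by_cases hω' : (r, c) = (i, j)
        · obtain ⟨rfl, rfl⟩ := Prod.mk.inj hω'
          rw [h.shift.last]
          exact (hT r c hm).1
        · have t := h.shift.before j le_rfl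
          -- The special entry is compared with the new entry of `(i, j)`; the gain per row in `T'`
          -- makes up for the difference of the lower bounds.
          have h5 := main i j ⟨le_rfl, h1, by simp only; omega, h.le_top _⟩ (Ne.symm hω')
          have h6 := h.after.le (r := i) (c := j) (h.act le_rfl (by omega)) hm h.row_le h1
          omega
      · exact main r c hp hne
    · have h5 := h.after.le (h.act h1 h3) h.mem hr h2
      rw [h.shift.last] at h5
      have := (hT i j hω).2
      omega
  · rw [h.shift.off r c hp]
    exact hT r c hm

/-- Undoing a down step raises an entry by one. It stays at most `b` because in `T'` at least one
further row lies between it and the entry of `(i', j')`. -/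
theorem range_before (h : SortsTo i j T T' i' j' top) {b : ℕ} (hT : InContentRange b T') :
    InContentRange b T := by
  intro r c hm
  have t := h.shift.before j le_rfl
  by_cases hp : OnPath j j' top (r, c)
  · obtain ⟨h1, h2, h3, h4⟩ := id hp
    simp only at h1 h2 h3 h4
    have hr := h4.trans (h.top_le _)
    have hend := (hT i' j' h.mem).2
    have hil := h.row_le
    rcases Nat.eq_or_lt_of_le h3 with h5 | h5
    · rcases Nat.eq_or_lt_of_le h1 with h6 | h6
      · have hω : (r, c) = (i, j) := by rw [← h5, ← h6, t]
        obtain ⟨rfl, rfl⟩ := Prod.mk.inj hω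
        rw [← h.shift.last]
        have h7 := h.after.le (h.act h1 h3) h.mem hr h2
        have h8 := (hT r c hm).1
        omega
      · obtain ⟨c, rfl⟩ : ∃ d, c = d + 1 := ⟨c - 1, by omega⟩
        have h7 := h.shift.right c (by omega) (by omega)
        rw [h5] at h7
        have h8 := hT r c (mem_of_le hm le_rfl (by omega))
        push_cast
        omega
    · obtain ⟨r, rfl⟩ : ∃ s, r = s + 1 := ⟨r - 1, by omega⟩
      have h7 := h.shift.down r c h1 h2 (by omega) (by omega)
      have h8 := hT r c (mem_of_le hm (by omega) le_rfl)
      have h9 := h.after.le (h.act h1 (show top c ≤ r by omega)) h.mem (by omega) h2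
      push_cast
      omega
  · rw [← h.shift.off r c hp]
    exact hT r c hm

end SortsTo

/-! ### One loop of each algorithm inverts the other. -/

theorem loopHC_spec {b i j : ℕ} {ω : Cell μ} (hω : ω.1 = (i, j)) {p : Filling μ × Filling μ}
    (h : IsState b (i + 1) j p) :
    IsState b i j (loopHC ω p) ∧ loopHCStar (loopHC ω p) ω = some p := by
  obtain ⟨T, H⟩ := p
  have hωm : (i, j) ∈ μ := (YoungDiagram.mem_cells _).1 (hω ▸ ω.2)
  have hω1 : ω.1.1 = i := by rw [hω]
  have hω2 : ω.1.2 = j := by rw [hω]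
  obtain ⟨f1, ⟨top, f2⟩, P, f3⟩ := forward_of_ordered hω h.ordered
  simp only [loopHC] at f1 f2 f3 ⊢
  generalize (jt T ω).1 = T' at f1 f2 f3 ⊢
  generalize (jt T ω).2 = e at f1 f2 f3 ⊢
  obtain ⟨⟨i', j'⟩, he⟩ := e
  simp only at f2
  have hem : (i', j') ∈ μ := (YoungDiagram.mem_cells _).1 he
  have s : SortsTo i j T T' i' j' top := ⟨h.ordered, f1, f2, hem⟩
  have hij := s.row_le
  have hjj := s.shift.le
  have hP : BackPath j T' (i, j) (i', j') P := by
    have := (jtStar_iff ω T' ⟨(i', j'), he⟩ P).1 ⟨_, f3⟩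
    rwa [hω] at this
  set H' := shiftUp ω ⟨(i', j'), he⟩ H with hH'
  have eH : ∀ {r c}, (r, c) ∈ μ → entry H' (r, c) =
      if c = j ∧ i ≤ r ∧ r < i' then entry H (r + 1, c) + 1
      else if (r, c) = (i', j) then (j : ℤ) - (j' : ℤ) else entry H (r, c) := by
    intro r c hm
    rw [hH', entry_shiftUp _ _ _ hm, hω]
  have hhook : InHookRange H' := by
    intro r c hm
    rw [eH hm]
    split_ifs with h1 h2
    · obtain ⟨rfl, h1, h2⟩ := h1
      have h3 := h.hook (r + 1) c (mem_of_le hem h2 hjj)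
      have h4 := μ.rowLen_anti r (r + 1) (by omega)
      push_cast at h3
      omega
    · obtain ⟨rfl, rfl⟩ := Prod.mk.inj h2
      rw [YoungDiagram.mem_iff_lt_colLen] at hm
      rw [YoungDiagram.mem_iff_lt_rowLen] at hem
      omega
    · exact h.hook r c hm
  have cand : ∀ k, i ≤ k → (k, j) ∈ μ → entry H' (k, j) ≤ 0 →
      ∃ L, BackPath j T' (i, j) (k, j + (-entry H' (k, j)).toNat) L ∧
        (k ≠ i' → comesBefore P L = true) := by
    intro k hik hm hk
    have hmc := hhook.mem hm
    rcases lt_trichotomy k i' with hki | rfl | hki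
    · have e1 := eH hm
      rw [if_pos ⟨rfl, hik, hki⟩] at e1
      have hm1 : (k + 1, j) ∈ μ := mem_of_le hem hki hjj
      obtain ⟨L, hL⟩ := h.reach (k + 1) (by omega) hm1 (by simp only; omega)
      have hmq := h.hook.mem hm1
      obtain ⟨r1, r2⟩ := s.top_lt_of_backPath hL hmq
      simp only at r1
      -- The new candidate of row `k` is the diagonal predecessor of the old candidate of row `k +
      -- 1`: the strict bound by `k + 1` on `top` becomes the weak bound by `k`.
      have e2 : (-entry H (k + 1, j)).toNat = (-entry H' (k, j)).toNat + 1 := by omega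
      simp only [e2, ← add_assoc] at r1
      have hnear : j + (-entry H' (k, j)).toNat ≤ j' := by
        by_contra hc
        have := s.shift.after (j + (-entry H' (k, j)).toNat + 1) (by omega)
        omega
      obtain ⟨L', hL', hc⟩ := s.comesBefore_of_top_le hP (k, j + (-entry H' (k, j)).toNat)
        (by simp only; omega) (by simp only; omega) (.near hnear) (by grind)
      exact ⟨L', hL', fun _ => hc⟩
    · have e1 := eH hm
      rw [if_neg (by omega), if_pos rfl] at e1
      have e2 : j + (-entry H' (k, j)).toNat = j' := by omega
      rw [e2]
      exact ⟨P, hP, fun h => absurd rfl h⟩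
    · have e1 := eH hm
      rw [if_neg (by omega), if_neg (by grind)] at e1
      rw [e1] at hk ⊢
      obtain ⟨L, hL⟩ := h.reach k (by omega) hm hk
      obtain ⟨r1, r2⟩ := s.top_lt_of_backPath hL (h.hook.mem hm)
      have := s.top_le (j + (-entry H (k, j)).toNat + 1)
      obtain ⟨L', hL', hc⟩ := s.comesBefore_of_top_le hP (k, j + (-entry H (k, j)).toNat)
        (by simp only; omega) (by simp only; omega) ((s.far_iff _).1 r2) (by grind)
      exact ⟨L', hL', fun _ => hc⟩
  have hst : IsState b i j (T', H') := by
    refine ⟨s.range_after h.range hωm, f1, hhook, fun r c hrc => ?_, fun k h1 h2 h3 => ?_⟩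
    · by_cases hm : (r, c) ∈ μ
      · rw [eH hm, if_neg (by unfold Act at hrc; omega), if_neg (by unfold Act at hrc; grind)]
        exact h.zero r c (by unfold Act at *; omega)
      · exact entry_of_notMem _ hm
    · obtain ⟨L, hL, -⟩ := cand k h1 h2 h3
      exact ⟨L, hL⟩
  refine ⟨hst, ?_⟩
  have hi'm : (i', j) ∈ μ := mem_of_le hem le_rfl hjj
  have ei' := eH hi'm
  rw [if_neg (by omega), if_pos rfl] at ei'
  have hee : j + (-entry H' (i', j)).toNat = j' := by omega
  rw [loopHCStar_eq (e := (i', j')) (T₀ := T) (P := P)]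
  · congr 2
    refine filling_ext fun r c hm => ?_
    rw [entry_shiftDown _ _ _ hm, hω]
    simp only
    split_ifs with h1 h2
    · rw [eH (mem_of_le hm (by omega) le_rfl), if_pos (by omega),
        show r - 1 + 1 = r by omega]
      ring
    · obtain ⟨rfl, rfl⟩ := Prod.mk.inj h2
      -- `shiftDown` writes `0` in `ω`, and that was the entry of `ω` before the loop.
      exact (h.zero r c (by unfold Act; omega)).symm
    · rw [eH hm, if_neg (by grind), if_neg (by grind)]
  · rw [mem_candidates, hω]
    exact ⟨i', hi'm, hij, by simp only; omega, by rw [hee]⟩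
  · exact backwardMove_eq f3
  · intro q hq hqe
    rw [mem_candidates, hω] at hq
    obtain ⟨k, h1, h2, h3, rfl⟩ := hq
    obtain ⟨L, hL, hc⟩ := cand k h2 h1 h3
    have hm := (YoungDiagram.mem_cells _).2 (hhook.mem h1)
    obtain ⟨T'', hT''⟩ := (jtStar_iff ω T' ⟨_, hm⟩ L).2 (by rw [hω]; exact hL)
    refine ⟨T'', L, backwardMove_eq hT'', hc ?_⟩
    rintro rfl
    exact hqe (by rw [hee])

theorem loopHCStar_spec {b i j : ℕ} {ω : Cell μ} (hω : ω.1 = (i, j)) {p : Filling μ × Filling μ}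
    (h : IsState b i j p) :
    ∃ p₀, IsState b (i + 1) j p₀ ∧ loopHCStar p ω = some p₀ ∧ loopHC ω p₀ = p := by
  obtain ⟨T, H⟩ := p
  have hωm : (i, j) ∈ μ := (YoungDiagram.mem_cells _).1 (hω ▸ ω.2)
  have hω1 : ω.1.1 = i := by rw [hω]
  have hω2 : ω.1.2 = j := by rw [hω]
  have hcand : ∀ q ∈ candidates ω H, q ∈ μ ∧ ∃ L, BackPath j T (i, j) q L := by
    intro q hq
    rw [mem_candidates, hω] at hq
    obtain ⟨k, h1, h2, h3, rfl⟩ := hq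
    exact ⟨h.hook.mem h1, h.reach k h2 h1 h3⟩
  -- The lowest cell of column `j` has leg length `0`, so its entry is nonpositive.
  have hne : candidates ω H ≠ [] := by
    have h1 := hωm
    rw [YoungDiagram.mem_iff_lt_colLen] at h1
    have h2 : (μ.colLen j - 1, j) ∈ μ := YoungDiagram.mem_iff_lt_colLen.2 (by omega)
    have h3 := (h.hook _ _ h2).2
    refine List.ne_nil_of_mem (mem_candidates.2 ⟨μ.colLen j - 1, ?_, ?_, ?_, rfl⟩) <;>
      rw [hω]
    · exact h2
    · simp only; omega
    · simp only at h3 ⊢; omega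
  obtain ⟨e, he, P, hP, hfirst⟩ := exists_first_backPath _ hne fun q hq => (hcand q hq).2
  have hem := (hcand e he).1
  have heC := (YoungDiagram.mem_cells _).2 hem
  obtain ⟨T₀, hT₀⟩ := (jtStar_iff ω T ⟨e, heC⟩ P).2 (by rw [hω]; exact hP)
  obtain ⟨g1, g2⟩ := backward_of_ordered hω h.ordered _ hT₀
  -- The backward move is described by the forward move that undoes it, so the comparison of
  -- backward paths with a sliding path applies.
  obtain ⟨-, ⟨top, f2⟩, -⟩ := forward_of_ordered hω g1
  rw [g2] at f2
  obtain ⟨i', j'⟩ := e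
  simp only at f2
  have s : SortsTo i j T₀ T i' j' top := ⟨g1, h.ordered, f2, hem⟩
  have hij := s.row_le
  have hjj := s.shift.le
  have hloop := loopHCStar_eq he (backwardMove_eq hT₀) fun q hq hqe => by
    obtain ⟨hqm, L, hL⟩ := hcand q hq
    obtain ⟨T', hT'⟩ := (jtStar_iff ω T ⟨q, (YoungDiagram.mem_cells _).2 hqm⟩ L).2
      (by rw [hω]; exact hL)
    exact ⟨T', L, backwardMove_eq hT', hfirst q hq hqe L hL⟩
  have heq : j' = j + (-entry H (i', j)).toNat ∧ entry H (i', j) ≤ 0 := by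
    rw [mem_candidates, hω] at he
    obtain ⟨k, h1, h2, h3, h4⟩ := he
    obtain ⟨rfl, h5⟩ := Prod.mk.inj h4
    exact ⟨h5, h3⟩
  have hcand' : ∀ k, i ≤ k → k ≠ i' → (k, j) ∈ μ → entry H (k, j) ≤ 0 →
      top (j + (-entry H (k, j)).toNat + 1) ≤ k ∧
        Far i' j' j T₀ (k, j + (-entry H (k, j)).toNat) := by
    intro k h1 h2 h3 h4
    have hq : (k, j + (-entry H (k, j)).toNat) ∈ candidates ω H := by
      rw [mem_candidates, hω]
      exact ⟨k, h3, h1, h4, rfl⟩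
    obtain ⟨-, L, hL⟩ := hcand _ hq
    obtain ⟨k1, k2⟩ := s.top_le_of_comesBefore hP hL (hfirst _ hq (by grind) L hL)
    exact ⟨k1, (s.far_iff _).2 k2⟩
  set H₀ := shiftDown ω i' H with hH₀
  have eH : ∀ {r c}, (r, c) ∈ μ → entry H₀ (r, c) =
      if c = j ∧ i < r ∧ r ≤ i' then entry H (r - 1, c) - 1
      else if (r, c) = (i, j) then 0 else entry H (r, c) := by
    intro r c hm
    rw [hH₀, entry_shiftDown _ _ _ hm, hω]
  -- Beyond column `j'` the value of `top` is `i' > k - 1`. So the candidate shifted diagonally to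
  -- row `k` is still in a column up to `j'`, and hence in `μ`.
  have hnear : ∀ k, i < k → k ≤ i' → entry H (k - 1, j) ≤ 0 →
      top (j + (-entry H (k - 1, j)).toNat + 1) ≤ k - 1 ∧
        j + (-entry H (k - 1, j)).toNat + 1 ≤ j' := by
    intro k h1 h2 h3
    obtain ⟨k1, -⟩ := hcand' (k - 1) (by omega) (by omega)
      (mem_of_le hem (by omega) hjj) h3
    refine ⟨k1, ?_⟩
    by_contra hc
    have := s.shift.after (j + (-entry H (k - 1, j)).toNat + 1) (by omega)
    omega
  have hhook : InHookRange H₀ := by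
    intro r c hm
    rw [eH hm]
    split_ifs with h1 h2
    · obtain ⟨rfl, h1, h2⟩ := h1
      have h3 := (h.hook (r - 1) c (mem_of_le hm (by omega) le_rfl)).2
      simp only at h3
      rw [YoungDiagram.mem_iff_lt_rowLen] at hm
      refine ⟨?_, by omega⟩
      rcases le_or_gt (entry H (r - 1, c)) 0 with h4 | h4
      · have h5 := (hnear r h1 h2 h4).2
        have h6 := YoungDiagram.mem_iff_lt_rowLen.1 (mem_of_le hem h2 h5)
        omega
      · omega
    · have h3 := YoungDiagram.mem_iff_lt_rowLen.1 hm
      have h4 := YoungDiagram.mem_iff_lt_colLen.1 hm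
      omega
    · exact h.hook r c hm
  refine ⟨(T₀, H₀), ⟨s.range_before h.range, g1, hhook, fun r c hrc => ?_, fun k h1 h2 h3 => ?_⟩,
    hloop, ?_⟩
  · by_cases hm : (r, c) ∈ μ
    · simp only
      rw [eH hm, if_neg (by unfold Act at hrc; omega)]
      split_ifs with h1
      · rfl
      · exact h.zero r c (by unfold Act at *; grind)
    · exact entry_of_notMem _ hm
  · simp only at h3 ⊢
    have hmc := hhook.mem h2
    have e1 := eH h2
    rcases le_or_gt k i' with hk | hk
    · rw [if_pos ⟨rfl, h1, hk⟩] at e1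
      rcases le_or_gt (entry H (k - 1, j)) 0 with h4 | h4
      · obtain ⟨k1, k2⟩ := hnear k h1 hk h4
        have e2 : j + (-entry H (k - 1, j)).toNat + 1 = j + (-entry H₀ (k, j)).toNat := by omega
        rw [e2] at k1 k2
        exact s.backPath_of_top_lt _ hmc (by simp only; omega) (by simp only; omega) (.near k2)
      -- A positive entry that becomes nonpositive was `1`: a new candidate appears in column `j`,
      -- below `top j = i`.
      · have e2 : j + (-entry H₀ (k, j)).toNat = j := by omega
        rw [e2] at hmc ⊢
        have := s.shift.before j le_rfl
        exact s.backPath_of_top_lt _ hmc le_rfl (by simp only; omega) (.near hjj)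
    · rw [if_neg (by omega), if_neg (by grind)] at e1
      rw [e1] at hmc h3 ⊢
      obtain ⟨-, k2⟩ := hcand' k (by omega) (by omega) h2 h3
      have := s.top_le (j + (-entry H (k, j)).toNat)
      exact s.backPath_of_top_lt _ hmc (by simp only; omega) (by simp only; omega) k2
  · simp only [loopHC, g2]
    congr 1
    refine filling_ext fun r c hm => ?_
    rw [entry_shiftUp _ _ _ hm, hω]
    simp only
    split_ifs with h1 h2
    · obtain ⟨rfl, h1, h2⟩ := h1
      rw [eH (mem_of_le hem h2 hjj), if_pos (by omega)]
      simp
    · obtain ⟨rfl, rfl⟩ := Prod.mk.inj h2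
      omega
    · rw [eH hm, if_neg (by grind), if_neg (by grind)]

/-! ### Preservation of the total norm. -/

theorem tabNorm_slide (T : Filling μ) (c d : Cell μ) (v : ℤ) (h : c ≠ d) :
    tabNorm (slide T c d v) = tabNorm T + (v - T d) := by
  have h1 : ∀ ρ, slide T c d v ρ =
      T ρ + (if ρ = c then v - T c else 0) + (if ρ = d then T c - T d else 0) := by
    intro ρ
    simp only [slide, Function.update_apply]
    by_cases h1 : ρ = d
    · subst h1
      simp [Ne.symm h]
    · by_cases h2 : ρ = c
      · subst h2
        simp [h]
      · simp [h1, h2]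
  simp only [tabNorm, h1, Finset.sum_add_distrib, Finset.sum_ite_eq', Finset.mem_univ, if_true]
  ring

theorem tabNorm_jt (T : Filling μ) (c : Cell μ) :
    tabNorm (jt T c).1 =
      tabNorm T + (((jt T c).2.1.2 : ℤ) - c.1.2) - (((jt T c).2.1.1 : ℤ) - c.1.1) := by
  induction hn : μ.colLen 0 + μ.rowLen 0 - (c.1.1 + c.1.2) using Nat.strong_induction_on
    generalizing T c with
  | _ n ih =>
  subst hn
  rcases jtStep_cases T c with ⟨h0, -, -⟩ | ⟨d, hd, hs, -, -⟩ | ⟨d, hd, hs, -, -⟩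
  · rw [jt_of_none h0]
    simp
  all_goals
    have hlt := cell_lt d
    have hcd : c ≠ d := by
      rintro rfl
      have h1 := congrArg Prod.fst hd
      have h2 := congrArg Prod.snd hd
      simp only at h1 h2
      omega
    rw [jt_of_some hs, ih _ (by rw [hd] at hlt ⊢; simp only at hlt ⊢; omega) _ d rfl]
    simp only
    rw [tabNorm_slide _ _ _ _ hcd, hd]
    push_cast
    ring

theorem sum_cells {M : Type*} [AddCommMonoid M] (f : ℕ × ℕ → M) :
    ∑ ρ : Cell μ, f ρ.1 = ∑ p ∈ μ.cells, f p :=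
  (Finset.sum_subtype μ.cells (fun _ => Iff.rfl) f).symm

theorem tabNorm_eq (F : Filling μ) : tabNorm F = ∑ p ∈ μ.cells, entry F p := by
  rw [← sum_cells]
  exact Finset.sum_congr rfl fun ρ _ => (entry_coe F ρ).symm

/-- The shifted entries telescope: only the entry of `ω` is lost, which is `0`. Each of the shifts
adds one, and the new entry accounts for the columns. -/
theorem tabNorm_shiftUp {ω ω' : Cell μ} (h1 : ω.1.1 ≤ ω'.1.1) (h2 : ω.1.2 ≤ ω'.1.2)
    (H : Filling μ) (h0 : entry H ω.1 = 0) :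
    tabNorm (shiftUp ω ω' H) =
      tabNorm H + ((ω'.1.1 : ℤ) - ω.1.1) - ((ω'.1.2 : ℤ) - ω.1.2) := by
  obtain ⟨⟨i, j⟩, hω⟩ := ω
  obtain ⟨⟨i', j'⟩, hω'⟩ := ω'
  simp only at h1 h2 h0 ⊢
  have hm : ∀ k, k ≤ i' → (k, j) ∈ μ := fun k hk =>
    mem_of_le ((YoungDiagram.mem_cells _).1 hω') hk h2
  set H' := shiftUp ⟨(i, j), hω⟩ ⟨(i', j'), hω'⟩ H with hH'
  have eH : ∀ {r c}, (r, c) ∈ μ → entry H' (r, c) =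
      if c = j ∧ i ≤ r ∧ r < i' then entry H (r + 1, c) + 1
      else if (r, c) = (i', j) then (j : ℤ) - (j' : ℤ) else entry H (r, c) := by
    intro r c hm
    rw [hH', entry_shiftUp _ _ _ hm]
  have tele : ∀ n, i ≤ n → ∑ k ∈ Finset.Ico i n, (entry H (k + 1, j) + 1 - entry H (k, j)) =
      entry H (n, j) - entry H (i, j) + ((n : ℤ) - i) := by
    intro n hn
    induction n, hn using Nat.le_induction with
    | base => simp
    | succ n hn ih =>
      rw [Finset.sum_Ico_succ_top hn, ih]
      push_cast
      ring
  have main : ∑ p ∈ μ.cells, (entry H' p - entry H p) =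
      ∑ k ∈ Finset.Ico i (i' + 1), (entry H' (k, j) - entry H (k, j)) := by
    rw [← Finset.sum_image (s := Finset.Ico i (i' + 1)) (g := fun k => (k, j))
      (f := fun p => entry H' p - entry H p) (by intro a _ b _ hab; exact (Prod.mk.inj hab).1)]
    symm
    apply Finset.sum_subset
    · intro p hp
      obtain ⟨k, hk, rfl⟩ := Finset.mem_image.1 hp
      rw [Finset.mem_Ico] at hk
      exact (YoungDiagram.mem_cells _).2 (hm k (by omega))
    · rintro ⟨r, c⟩ hp hp'
      have h3 : ¬ (c = j ∧ i ≤ r ∧ r ≤ i') := by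
        rintro ⟨rfl, h3, h4⟩
        exact hp' (Finset.mem_image.2 ⟨r, Finset.mem_Ico.2 ⟨h3, by omega⟩, rfl⟩)
      rw [eH ((YoungDiagram.mem_cells _).1 hp), if_neg (by omega), if_neg (by grind)]
      ring
  have last : entry H' (i', j) = (j : ℤ) - j' := by
    rw [eH (hm i' le_rfl), if_neg (by omega), if_pos rfl]
  have low : ∑ k ∈ Finset.Ico i i', (entry H' (k, j) - entry H (k, j)) =
      ∑ k ∈ Finset.Ico i i', (entry H (k + 1, j) + 1 - entry H (k, j)) := by
    refine Finset.sum_congr rfl fun k hk => ?_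
    rw [Finset.mem_Ico] at hk
    rw [eH (hm k (by omega)), if_pos ⟨rfl, hk⟩]
  rw [Finset.sum_sub_distrib, ← tabNorm_eq, ← tabNorm_eq, Finset.sum_Ico_succ_top h1, low,
    tele i' h1, last, h0] at main
  linarith

theorem tabNorm_loopHC {i j : ℕ} {ω : Cell μ} (hω : ω.1 = (i, j)) {p : Filling μ × Filling μ}
    (h : Ordered (i + 1) j p.1) (h0 : entry p.2 ω.1 = 0) :
    tabNorm (loopHC ω p).1 + tabNorm (loopHC ω p).2 = tabNorm p.1 + tabNorm p.2 := by
  obtain ⟨-, -, L, hL⟩ := forward_of_ordered hω h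
  have hle := ((jtStar_iff ω _ _ L).1 ⟨_, hL⟩).le
  simp only [loopHC]
  rw [tabNorm_jt, tabNorm_shiftUp hle.1 hle.2 _ h0]
  ring

/-! ### Composing the loops over all cells. -/

/-- The loops for the cells in `l` of the two algorithms are inverse to each other, for the pairs
satisfying `I` before (in terms of Algorithm HC) and `J` after these loops. -/
def LoopsInverse (l : List (Cell μ)) (I J : Filling μ × Filling μ → Prop) : Prop :=
  (∀ p, I p → J (l.foldr loopHC p) ∧ l.foldlM loopHCStar (l.foldr loopHC p) = some p ∧
    tabNorm (l.foldr loopHC p).1 + tabNorm (l.foldr loopHC p).2 = tabNorm p.1 + tabNorm p.2) ∧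
  ∀ p, J p → ∃ p₀, I p₀ ∧ l.foldlM loopHCStar p = some p₀ ∧ l.foldr loopHC p₀ = p

theorem LoopsInverse.nil {I J : Filling μ × Filling μ → Prop} (h : ∀ p, I p ↔ J p) :
    LoopsInverse [] I J :=
  ⟨fun p hp => ⟨(h p).1 hp, rfl, rfl⟩, fun p hp => ⟨p, (h p).2 hp, rfl, rfl⟩⟩

theorem LoopsInverse.append {l₁ l₂ : List (Cell μ)} {I J K : Filling μ × Filling μ → Prop}
    (h₁ : LoopsInverse l₁ K J) (h₂ : LoopsInverse l₂ I K) : LoopsInverse (l₁ ++ l₂) I J := by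
  refine ⟨fun p hp => ?_, fun p hp => ?_⟩
  · obtain ⟨a1, a2, a3⟩ := h₂.1 p hp
    obtain ⟨b1, b2, b3⟩ := h₁.1 _ a1
    rw [List.foldr_append, List.foldlM_append, b2]
    exact ⟨b1, a2, b3.trans a3⟩
  · obtain ⟨q, b1, b2, b3⟩ := h₁.2 p hp
    obtain ⟨p₀, a1, a2, a3⟩ := h₂.2 q b1
    refine ⟨p₀, a1, ?_, ?_⟩
    · rw [List.foldlM_append, b2]
      exact a2
    · rw [List.foldr_append, a3, b3]

theorem LoopsInverse.singleton {b i j : ℕ} {ω : Cell μ} (hω : ω.1 = (i, j)) :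
    LoopsInverse [ω] (IsState b (i + 1) j) (IsState b i j) := by
  refine ⟨fun p hp => ?_, fun p hp => ?_⟩
  · obtain ⟨h1, h2⟩ := loopHC_spec hω hp
    refine ⟨h1, by simpa using h2, tabNorm_loopHC hω hp.ordered ?_⟩
    rw [hω]
    exact hp.zero i j (by unfold Act; omega)
  · obtain ⟨p₀, h1, h2, h3⟩ := loopHCStar_spec hω hp
    exact ⟨p₀, h1, by simpa using h2, h3⟩

/-- In row `0` a path can only go left and in column `j` only up, so it cannot miss `(0, j)`. -/
theorem exists_backPath_zero (j : ℕ) (T : Filling μ) (q : ℕ × ℕ) (hq : j ≤ q.2) :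
    ∃ L, BackPath j T (0, j) q L := by
  induction hn : q.1 + q.2 using Nat.strong_induction_on generalizing q with
  | _ n ih =>
  subst hn
  by_cases h : q = (0, j)
  · rw [h]; exact ⟨_, .base⟩
  have h0 : q.1 ≠ 0 ∨ j < q.2 := by
    by_contra h'
    exact h (Prod.ext (by simp only; omega) (by simp only; omega))
  have key : j ≤ (backStep j T q).2 ∧ (backStep j T q).1 + (backStep j T q).2 < q.1 + q.2 := by
    unfold backStep
    split_ifs with hs <;> simp only <;> omega
  obtain ⟨L, hL⟩ := ih _ key.2 _ key.1 rfl
  exact ⟨_, .step h h0 hL⟩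

/-- Passing from the top of one column to the bottom of the previous one: `reach` is automatic for
row `0`, and vacuous past the end of a column. -/
theorem isState_column_iff {b j : ℕ} (p : Filling μ × Filling μ) :
    IsState b 0 (j + 1) p ↔ IsState b (μ.colLen j) j p := by
  have hmem : ∀ r, (r, j) ∈ μ → r < μ.colLen j := fun r h => YoungDiagram.mem_iff_lt_colLen.1 h
  constructor <;> intro h
  · refine ⟨h.range, ⟨fun r c ha hm => ?_, fun r c ha hm => ?_⟩, h.hook, fun r c ha => ?_,
      fun k hk hm => ?_⟩
    · refine h.ordered.row r c ?_ hm
      rcases ha with ha | ⟨rfl, ha⟩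
      · unfold Act; omega
      · have := hmem r (mem_of_le hm le_rfl (by omega))
        omega
    · refine h.ordered.col r c ?_ hm
      rcases ha with ha | ⟨rfl, ha⟩
      · unfold Act; omega
      · have := hmem _ hm
        omega
    · exact h.zero r c (by unfold Act at *; omega)
    · have := hmem k hm
      omega
  · refine ⟨h.range, ⟨fun r c ha hm => ?_, fun r c ha hm => ?_⟩, h.hook, fun r c ha => ?_,
      fun k hk hm _ => exists_backPath_zero _ _ _ (by simp only; omega)⟩
    · exact h.ordered.row r c (by unfold Act at *; omega) hm
    · exact h.ordered.col r c (by unfold Act at *; omega) hm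
    · by_cases hm : (r, c) ∈ μ
      · refine h.zero r c ?_
        unfold Act at *
        rintro (h1 | ⟨rfl, h1⟩)
        · omega
        · have := hmem r hm
          omega
      · exact entry_of_notMem _ hm

theorem loopsInverse_column (b j n : ℕ) (hn : n ≤ μ.colLen j)
    (f : ∀ i, i < μ.colLen j → Cell μ) (hf : ∀ i h, (f i h).1 = (i, j))
    (hl : ∀ i ∈ List.range n, i < μ.colLen j) :
    LoopsInverse ((List.range n).pmap f hl) (IsState b n j) (IsState b 0 j) := by
  induction n with
  | zero => exact .nil fun _ => Iff.rfl
  | succ n ih =>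
    have := (ih (by omega) fun i hi => hl i (by simp at hi ⊢; omega)).append
      (LoopsInverse.singleton (b := b) (hf n (by omega)))
    simpa only [List.range_succ, List.pmap_append, List.pmap_cons, List.pmap_nil] using this

theorem loopsInverse_cellList (b : ℕ) :
    LoopsInverse (cellList μ) (IsState b 0 (μ.rowLen 0)) (IsState b 0 0) := by
  unfold cellList
  generalize μ.rowLen 0 = m
  induction m with
  | zero => exact .nil fun _ => Iff.rfl
  | succ m ih =>
    rw [List.range_succ, List.flatMap_append]
    refine ih.append ?_
    rw [List.flatMap_cons, List.flatMap_nil, List.append_nil,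
      funext fun p => propext (isState_column_iff (b := b) (j := m) p)]
    exact loopsInverse_column b m _ le_rfl _ (fun _ _ => rfl) _

/-- All cells are in columns before `μ.rowLen 0`, so nothing has to be ordered yet and `zero`
applies to every cell. -/
theorem isState_initial_iff {b : ℕ} (p : Filling μ × Filling μ) :
    IsState b 0 (μ.rowLen 0) p ↔ p.1 ∈ contentTabloids μ b ∧ p.2 = 0 := by
  have hmem : ∀ r c, (r, c) ∈ μ → c < μ.rowLen 0 := fun r c h =>
    YoungDiagram.mem_iff_lt_rowLen.1 (mem_of_le h (Nat.zero_le _) le_rfl)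
  have hz : ∀ q, entry (0 : Filling μ) q = 0 := fun q => by simp [entry]
  simp only [contentTabloids, Fintype.mem_piFinset, Finset.mem_Icc, content]
  constructor
  · intro h
    refine ⟨fun ρ => ?_, filling_ext fun r c hm => ?_⟩
    · have := h.range ρ.1.1 ρ.1.2 ((YoungDiagram.mem_cells _).1 ρ.2)
      rwa [Prod.mk.eta, entry_coe] at this
    · rw [hz]
      have := hmem r c hm
      exact h.zero r c (by unfold Act; omega)
  · rintro ⟨h1, h2⟩
    obtain ⟨T, H⟩ := p
    simp only at h1 h2
    subst h2
    refine ⟨fun r c hm => ?_, ⟨fun r c ha hm => ?_, fun r c ha hm => ?_⟩, fun r c hm => ?_,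
      fun r c _ => hz _, fun k _ _ _ => exists_backPath_zero _ _ _ (by simp only; omega)⟩
    · simp only
      rw [entry_mk _ _ ((YoungDiagram.mem_cells _).2 hm)]
      exact h1 ⟨(r, c), (YoungDiagram.mem_cells _).2 hm⟩
    · have := hmem _ _ hm
      unfold Act at ha
      omega
    · have := hmem _ _ hm
      unfold Act at ha
      omega
    · simp only
      rw [hz]
      have := YoungDiagram.mem_iff_lt_colLen.1 hm
      have := YoungDiagram.mem_iff_lt_rowLen.1 hm
      omega

/-- For a tableau, the bounds of content tabloids and the bounds `1` and `b` agree: the corner has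
content `0` and the smallest entry, while conversely the entries of row `r` (from `0`) are at least
`1 + r`. -/
theorem isState_final_iff {b : ℕ} (p : Filling μ × Filling μ) :
    IsState b 0 0 p ↔ p ∈ tableaux μ b ×ˢ hookTabloids μ := by
  have act : ∀ r c, Act 0 0 r c := fun r c => by unfold Act; omega
  have hmem : ∀ ρ : Cell μ, (ρ.1.1, ρ.1.2) ∈ μ := fun ρ => (YoungDiagram.mem_cells _).1 ρ.2
  simp only [Finset.mem_product, tableaux, hookTabloids, Finset.mem_filter, Fintype.mem_piFinset,
    Finset.mem_Icc, arm, leg]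
  constructor
  · intro h
    refine ⟨⟨fun ρ => ?_, fun ρ σ h1 h2 => ?_, fun ρ σ h1 h2 => ?_⟩, fun ρ => ?_⟩
    · have h1 := h.range ρ.1.1 ρ.1.2 (hmem ρ)
      have h2 := (h.range 0 0 (mem_of_le (hmem ρ) (Nat.zero_le _) (Nat.zero_le _))).1
      have h3 := h.ordered.le (act 0 0) (hmem ρ) (Nat.zero_le _) (Nat.zero_le _)
      rw [Prod.mk.eta, entry_coe] at h1 h3
      push_cast at h2 h3
      omega
    · have h3 := h.ordered.le (act ρ.1.1 ρ.1.2) (hmem σ) h1.le h2.le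
      rw [Prod.mk.eta, Prod.mk.eta, entry_coe, entry_coe] at h3
      omega
    · have h3 := h.ordered.le (act ρ.1.1 ρ.1.2) (hmem σ) h2.le h1.le
      rw [Prod.mk.eta, Prod.mk.eta, entry_coe, entry_coe] at h3
      omega
    · have h1 := h.hook ρ.1.1 ρ.1.2 (hmem ρ)
      rwa [Prod.mk.eta, entry_coe] at h1
  · rintro ⟨⟨h1, h2, h3⟩, h4⟩
    have ord : Ordered 0 0 p.1 := by
      refine ⟨fun r c _ hm => ?_, fun r c _ hm => ?_⟩
      · have hm' : (r, c) ∈ μ := mem_of_le hm le_rfl (by omega)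
        rw [entry_mk _ _ ((YoungDiagram.mem_cells _).2 hm),
          entry_mk _ _ ((YoungDiagram.mem_cells _).2 hm')]
        exact h2 _ _ rfl (Nat.lt_succ_self c)
      · have hm' : (r, c) ∈ μ := mem_of_le hm (by omega) le_rfl
        rw [entry_mk _ _ ((YoungDiagram.mem_cells _).2 hm),
          entry_mk _ _ ((YoungDiagram.mem_cells _).2 hm')]
        exact h3 _ _ rfl (Nat.lt_succ_self r)
    refine ⟨fun r c hm => ?_, ord, fun r c hm => ?_, fun r c ha => absurd (act r c) ha,
      fun k _ _ _ => exists_backPath_zero _ _ _ (by simp only; omega)⟩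
    · have hm0 : (0, c) ∈ μ := mem_of_le hm (Nat.zero_le _) le_rfl
      have h5 := ord.le (act 0 c) hm (Nat.zero_le _) le_rfl
      have h6 := (h1 ⟨_, (YoungDiagram.mem_cells _).2 hm0⟩).1
      have h7 := (h1 ⟨_, (YoungDiagram.mem_cells _).2 hm⟩).2
      rw [← entry_mk p.1] at h6 h7
      push_cast at h5
      omega
    · have h5 := h4 ⟨_, (YoungDiagram.mem_cells _).2 hm⟩
      rwa [← entry_mk p.2] at h5

theorem algHCStar_algHC {b : ℕ} {C : Filling μ} (hC : C ∈ contentTabloids μ b) :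
    algHC C ∈ tableaux μ b ×ˢ hookTabloids μ ∧ algHCStar (algHC C) = some C ∧
      tabNorm (algHC C).1 + tabNorm (algHC C).2 = tabNorm C := by
  obtain ⟨h1, h2, h3⟩ := (loopsInverse_cellList b).1 (C, 0) ((isState_initial_iff _).2 ⟨hC, rfl⟩)
  refine ⟨(isState_final_iff _).1 h1, ?_, h3.trans (by simp [tabNorm])⟩
  unfold algHCStar algHC
  rw [h2]
  rfl

theorem exists_algHC_eq {b : ℕ} {p : Filling μ × Filling μ}
    (hp : p ∈ tableaux μ b ×ˢ hookTabloids μ) :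
    ∃ C ∈ contentTabloids μ b, algHCStar p = some C ∧ algHC C = p := by
  obtain ⟨⟨C, H⟩, h1, h2, h3⟩ := (loopsInverse_cellList b).2 p ((isState_final_iff p).2 hp)
  obtain ⟨hC, hH⟩ := (isState_initial_iff _).1 h1
  simp only at hC hH
  subst hH
  exact ⟨C, hC, by simp [algHCStar, h2], h3⟩

/-! ### Generating functions. -/

theorem zpow_sum {ι F : Type*} [Field F] (x : F) (hx : x ≠ 0) (s : Finset ι) (f : ι → ℤ) :
    x ^ (∑ i ∈ s, f i) = ∏ i ∈ s, x ^ f i := by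
  classical
  induction s using Finset.induction_on with
  | empty => simp
  | insert a s ha ih => rw [Finset.sum_insert ha, Finset.prod_insert ha, zpow_add₀ hx, ih]

theorem sum_zpow_piFinset {F : Type*} [Field F] (x : F) (hx : x ≠ 0) (t : Cell μ → Finset ℤ) :
    ∑ C ∈ Fintype.piFinset t, x ^ tabNorm C = ∏ ρ, ∑ k ∈ t ρ, x ^ k := by
  rw [Finset.prod_univ_sum]
  exact Finset.sum_congr rfl fun C _ => zpow_sum x hx _ _

theorem sum_tableaux_mul {F : Type*} [Field F] (x : F) (hx : x ≠ 0) (μ : YoungDiagram) (b : ℕ) :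
    (∑ T ∈ tableaux μ b, x ^ tabNorm T) * ∏ ρ : Cell μ, ∑ k ∈ Finset.Icc (-arm ρ) (leg ρ), x ^ k =
      ∏ ρ : Cell μ, ∑ k ∈ Finset.Icc (1 - content ρ) (b : ℤ), x ^ k := by
  rw [← sum_zpow_piFinset x hx, ← sum_zpow_piFinset x hx]
  change _ * ∑ H ∈ hookTabloids μ, _ = ∑ C ∈ contentTabloids μ b, _
  rw [Finset.sum_mul_sum, ← Finset.sum_product']
  symm
  refine Finset.sum_nbij algHC (fun C hC => (algHCStar_algHC hC).1) ?_ ?_ fun C hC => ?_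
  · intro C hC D hD h
    have h1 := (algHCStar_algHC hC).2.1
    rw [h, (algHCStar_algHC hD).2.1] at h1
    exact (Option.some.inj h1).symm
  · intro p hp
    obtain ⟨C, hC, -, h⟩ := exists_algHC_eq hp
    exact ⟨C, hC, h⟩
  · rw [← zpow_add₀ hx, (algHCStar_algHC hC).2.2]

/-- Admitting `a = b + 1` makes the empty sum the base of the induction on the number of terms. -/
theorem sum_zpow_Icc {F : Type*} [Field F] (x : F) (hx : x ≠ 0) (a b : ℤ) (h : a ≤ b + 1) :
    (∑ k ∈ Finset.Icc a b, x ^ k) * (1 - x) = x ^ a * (1 - x ^ (b + 1 - a)) := by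
  obtain ⟨n, rfl⟩ : ∃ n : ℕ, b = a - 1 + n := ⟨(b + 1 - a).toNat, by omega⟩
  clear h
  induction n with
  | zero => simp
  | succ n ih =>
    have h1 : Finset.Icc a (a - 1 + (n + 1 : ℕ)) = insert (a + n) (Finset.Icc a (a - 1 + n)) := by
      ext k
      simp only [Finset.mem_Icc, Finset.mem_insert]
      push_cast
      omega
    rw [h1, Finset.sum_insert (by simp only [Finset.mem_Icc]; omega), add_mul, ih,
      show a - 1 + (n : ℤ) + 1 - a = n by ring,
      show a - 1 + ((n + 1 : ℕ) : ℤ) + 1 - a = n + 1 by push_cast; ring, zpow_add₀ hx,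
      zpow_add_one₀ hx]
    ring

theorem ratFunc_X_zpow_ne_one {n : ℤ} (hn : 0 < n) : 1 - (RatFunc.X : RatFunc ℚ) ^ n ≠ 0 := by
  obtain ⟨m, rfl⟩ := Int.eq_ofNat_of_zero_le hn.le
  have hm : m ≠ 0 := by rintro rfl; simp at hn
  intro h
  have h1 : algebraMap (Polynomial ℚ) (RatFunc ℚ) (Polynomial.X ^ m) =
      algebraMap (Polynomial ℚ) (RatFunc ℚ) 1 := by
    rw [map_pow, RatFunc.algebraMap_X, map_one]
    rw [zpow_natCast] at h
    exact (sub_eq_zero.1 h).symm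
  have h2 := congrArg Polynomial.natDegree (RatFunc.algebraMap_injective ℚ h1)
  rw [Polynomial.natDegree_X_pow, Polynomial.natDegree_one] at h2
  exact hm h2

theorem hook_pos (ρ : Cell μ) : 0 < hook ρ := by
  have hm : (ρ.1.1, ρ.1.2) ∈ μ := (YoungDiagram.mem_cells _).1 ρ.2
  have h1 := YoungDiagram.mem_iff_lt_rowLen.1 hm
  have h2 := YoungDiagram.mem_iff_lt_colLen.1 hm
  unfold hook arm leg
  omega

/-- This is the power of `q` left over from the geometric sums: `1 - c_ρ` from the content factors
and `a_ρ` from the inverted hook factors. A row `i` of length `n` contributes the sum of `i + n - 2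
* c` over `c < n`. -/
theorem sum_one_sub_content_add_arm (μ : YoungDiagram) :
    ∑ ρ : Cell μ, (1 - content ρ + arm ρ) =
      ((∑ i ∈ Finset.range (μ.colLen 0), (i + 1) * μ.rowLen i : ℕ) : ℤ) := by
  have h1 := sum_cells (μ := μ) fun p : ℕ × ℕ =>
    (1 - ((p.2 : ℤ) - p.1) + ((μ.rowLen p.1 : ℤ) - p.2 - 1))
  refine h1.trans ?_
  have h2 : ∀ p : ℕ × ℕ, p ∈ μ.cells ↔
      p.1 ∈ Finset.range (μ.colLen 0) ∧ p.2 ∈ Finset.range (μ.rowLen p.1) := by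
    rintro ⟨r, c⟩
    rw [YoungDiagram.mem_cells, Finset.mem_range, Finset.mem_range]
    constructor
    · intro h
      exact ⟨YoungDiagram.mem_iff_lt_colLen.1 (mem_of_le h le_rfl (Nat.zero_le _)),
        YoungDiagram.mem_iff_lt_rowLen.1 h⟩
    · intro h
      exact YoungDiagram.mem_iff_lt_rowLen.2 h.2
  rw [Finset.sum_finset_product' μ.cells (Finset.range (μ.colLen 0))
    (fun i => Finset.range (μ.rowLen i)) h2
    (f := fun r c => (1 - ((c : ℤ) - r) + ((μ.rowLen r : ℤ) - c - 1)))]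
  push_cast
  refine Finset.sum_congr rfl fun i _ => ?_
  -- The row length `m` is kept apart from the number `n` of summands, so that it stays fixed in the
  -- induction.
  have h3 : ∀ n m : ℕ, ∑ c ∈ Finset.range n, (1 - ((c : ℤ) - i) + ((m : ℤ) - c - 1)) =
      n * (i + m - n + 1) := by
    intro n m
    induction n with
    | zero => simp
    | succ n ih =>
      rw [Finset.sum_range_succ, ih]
      push_cast
      ring
  rw [h3]
  ring

end HookContent

theorem theorem1 (μ : YoungDiagram) (b : ℕ) (hb : μ.colLen 0 ≤ b) :
    -- Algorithm HC is a bijection from content tabloids to pairs (tableau, hook tabloid)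
    Set.BijOn (HookContent.algHC (μ := μ))
      (↑(HookContent.contentTabloids μ b))
      (↑(HookContent.tableaux μ b ×ˢ HookContent.hookTabloids μ)) ∧
    -- which is weight-preserving
    (∀ C ∈ HookContent.contentTabloids μ b,
      HookContent.tabNorm (HookContent.algHC C).1 + HookContent.tabNorm (HookContent.algHC C).2
        = HookContent.tabNorm C) ∧
    -- Algorithm HC* is well-defined on all such pairs, produces content tabloids, and is the
    -- two-sided inverse of Algorithm HC
    (∀ p ∈ HookContent.tableaux μ b ×ˢ HookContent.hookTabloids μ,
      ∃ C ∈ HookContent.contentTabloids μ b,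
        HookContent.algHCStar p = some C ∧ HookContent.algHC C = p) ∧
    (∀ C ∈ HookContent.contentTabloids μ b,
      HookContent.algHCStar (HookContent.algHC C) = some C) ∧
    -- the identity with the hook product brought to the other side
    (∑ T ∈ HookContent.tableaux μ b, (RatFunc.X : RatFunc ℚ) ^ HookContent.tabNorm T) *
        ∏ ρ : HookContent.Cell μ,
          ∑ k ∈ Finset.Icc (-HookContent.arm ρ) (HookContent.leg ρ), (RatFunc.X : RatFunc ℚ) ^ k
      = ∏ ρ : HookContent.Cell μ,
          ∑ k ∈ Finset.Icc (1 - HookContent.content ρ) (b : ℤ), (RatFunc.X : RatFunc ℚ) ^ k ∧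
    -- the hook-content formula
    ∑ T ∈ HookContent.tableaux μ b, (RatFunc.X : RatFunc ℚ) ^ HookContent.tabNorm T
      = (RatFunc.X : RatFunc ℚ) ^ (∑ i ∈ Finset.range (μ.colLen 0), (i + 1) * μ.rowLen i) *
        ∏ ρ : HookContent.Cell μ,
          (1 - (RatFunc.X : RatFunc ℚ) ^ ((b : ℤ) + HookContent.content ρ)) /
            (1 - (RatFunc.X : RatFunc ℚ) ^ HookContent.hook ρ) := by
  have hX : (RatFunc.X : RatFunc ℚ) ≠ 0 := RatFunc.X_ne_zero
  have hmul := HookContent.sum_tableaux_mul (RatFunc.X : RatFunc ℚ) hX μ b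
  refine ⟨⟨fun C hC => (HookContent.algHCStar_algHC hC).1, fun C hC D hD h => ?_, fun p hp => ?_⟩,
    fun C hC => (HookContent.algHCStar_algHC hC).2.2, fun p hp => HookContent.exists_algHC_eq hp,
    fun C hC => (HookContent.algHCStar_algHC hC).2.1, hmul, ?_⟩
  · have h1 := (HookContent.algHCStar_algHC hC).2.1
    rw [h, (HookContent.algHCStar_algHC hD).2.1] at h1
    exact (Option.some.inj h1).symm
  · obtain ⟨C, hC, -, h⟩ := HookContent.exists_algHC_eq hp
    exact ⟨C, hC, h⟩
  · have h1X : 1 - (RatFunc.X : RatFunc ℚ) ≠ 0 := by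
      simpa using HookContent.ratFunc_X_zpow_ne_one (n := 1) one_pos
    have hhook : ∀ ρ : HookContent.Cell μ,
        ∑ k ∈ Finset.Icc (-HookContent.arm ρ) (HookContent.leg ρ), (RatFunc.X : RatFunc ℚ) ^ k =
          RatFunc.X ^ (-HookContent.arm ρ) * (1 - RatFunc.X ^ HookContent.hook ρ) /
            (1 - RatFunc.X) := by
      intro ρ
      have hp := HookContent.hook_pos ρ
      rw [eq_div_iff h1X, HookContent.sum_zpow_Icc _ hX _ _
        (by unfold HookContent.hook at hp; omega)]
      congr 3
      unfold HookContent.hook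
      ring
    have hcont : ∀ ρ : HookContent.Cell μ,
        ∑ k ∈ Finset.Icc (1 - HookContent.content ρ) (b : ℤ), (RatFunc.X : RatFunc ℚ) ^ k =
          RatFunc.X ^ (1 - HookContent.content ρ) *
            (1 - RatFunc.X ^ ((b : ℤ) + HookContent.content ρ)) / (1 - RatFunc.X) := by
      intro ρ
      -- With `hb` the row index is below `b`, so the content interval satisfies the bound required
      -- by `sum_zpow_Icc`.
      have hp := (HookContent.cell_lt ρ).1
      rw [eq_div_iff h1X, HookContent.sum_zpow_Icc _ hX _ _
        (by unfold HookContent.content; omega)]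
      congr 3
      ring
    have hne : ∏ ρ : HookContent.Cell μ, ∑ k ∈ Finset.Icc (-HookContent.arm ρ) (HookContent.leg ρ),
        (RatFunc.X : RatFunc ℚ) ^ k ≠ 0 := by
      refine Finset.prod_ne_zero_iff.2 fun ρ _ => ?_
      rw [hhook]
      exact div_ne_zero (mul_ne_zero (zpow_ne_zero _ hX)
        (HookContent.ratFunc_X_zpow_ne_one (HookContent.hook_pos ρ))) h1X
    rw [eq_div_of_mul_eq hne hmul, ← Finset.prod_div_distrib, ← zpow_natCast RatFunc.X,
      ← HookContent.sum_one_sub_content_add_arm, HookContent.zpow_sum _ hX,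
      ← Finset.prod_mul_distrib]
    refine Finset.prod_congr rfl fun ρ _ => ?_
    have h2 := HookContent.ratFunc_X_zpow_ne_one (HookContent.hook_pos ρ)
    rw [hhook, hcont, zpow_add₀ hX (1 - HookContent.content ρ) (HookContent.arm ρ), zpow_neg]
    have h3 := zpow_ne_zero (HookContent.arm ρ) hX
    field_simp
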